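/- Let $n\ge 1$ and $s\in\mathbb R$. Let $\omega_{FS}$ be the Fubini--Study form on $\mathbb{CP}^n$, normalized such that the generator of $H_2(\mathbb{CP}^n,\mathbb Z)$ has area $4\pi$, let $g$ be the Fubini--Study metric and $j$ the complex structure, so that $\omega_{FS}(\cdot,\cdot)=g(j\cdot,\cdot)$. (Concretely, $\mathbb{CP}^n$ is the adjoint orbit of $Z=\frac{1}{n+1}\mathrm{diag}(-i,\dots,-i,ni)$ in $\mathfrak{su}(n+1)$, $g$ is the restriction of the scalar product $(X,Y)=-2\,\mathrm{tr}(XY)$, and $j_xv=[x,v]$.) Let $D_1\mathbb{CP}^n=\{(x,v)\in T\mathbb{CP}^n : g_x(v,v)<1\}$ with projection $\pi$ to $\mathbb{CP}^n$, let $\lambda_{(x,v)}(\xi)=g_x(v,\mathrm d\pi\,\xi)$, let $$\bar\Delta=\{(p,q)\in\mathbb{CP}^n\times\mathbb{CP}^n : \mathrm{dist}(p,q)\text{ is maximal}\},$$ where $\mathrm{dist}$ is the Riemannian distance, and set $$R_1=\tfrac12\left(\sqrt{s^2+1}-s\right),\qquad R_2=\tfrac12\left(\sqrt{s^2+1}+s\right).$$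 Then there is a symplectomorphism $$F:(D_1\mathbb{CP}^n,\ \mathrm d\lambda-s\,\pi^*\omega_{FS})\to(\mathbb{CP}^n\times\mathbb{CP}^n\setminus\bar\Delta,\ R_1\omega_{FS}\ominus R_2\omega_{FS})$$ (a diffeomorphism onto the right-hand side that pulls back $R_1\mathrm{pr}_1^*\omega_{FS}-R_2\mathrm{pr}_2^*\omega_{FS}$ to $\mathrm d\lambda-s\pi^*\omega_{FS}$) which is equivariant for the induced action of $\mathrm{SU}(n+1)$ on the tangent bundle and its diagonal action on the product. Both actions are Hamiltonian, with moment maps $\mu_1,\mu_2$ into $\mathfrak{su}(n+1)\cong\mathfrak{su}(n+1)^*$ that satisfy $\mu_2\circ F=\mu_1$. Moreover $F$ has the form $$F(x,v)=\left(\exp_x(-c_1(|v|)\,j_xv),\ \exp_x(c_2(|v|)\,j_xv)\right)$$ for two real functions $c_1,c_2$ of $|v|=\sqrt{g_x(v,v)}$, where $\exp$ is the Riemannian exponential map. -/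

import Mathlib

open scoped Matrix Matrix.Norms.Frobenius ContDiff Topology

noncomputable section

namespace CPn

/-! ### Embedded submanifolds of a normed space

A submanifold is given as a subset `M` of a normed space `E`.  Tangent vectors are velocities of
smooth curves in `M`, smooth maps are those which locally extend to smooth maps of open sets, the
differential of `F` sends the velocity of `γ` to the velocity of `F ∘ γ`, and a two-form on `M` is
the restriction to tangent vectors of a map `E → E → E → ℝ` (base point, vector, vector). -/

section Submanifolds

/-- `γ` is a smooth curve in `M`, defined near time `0`, which passes through `p` at time `0`. -/
def IsCurveThrough {E : Type*} [NormedAddCommGroup E] [NormedSpace ℝ E]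
    (M : Set E) (p : E) (γ : ℝ → E) : Prop :=
  γ 0 = p ∧ ∃ ε : ℝ, 0 < ε ∧ ContDiffOn ℝ ∞ γ (Set.Ioo (-ε) ε) ∧ ∀ t ∈ Set.Ioo (-ε) ε, γ t ∈ M

/-- The tangent space `T_p M`. -/
def tangentVectors {E : Type*} [NormedAddCommGroup E] [NormedSpace ℝ E]
    (M : Set E) (p : E) : Set E :=
  {ξ | ∃ γ : ℝ → E, IsCurveThrough M p γ ∧ deriv γ 0 = ξ}

/-- `f` is a smooth map on `M`. -/
def IsSmoothOn {E E' : Type*} [NormedAddCommGroup E] [NormedSpace ℝ E]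
    [NormedAddCommGroup E'] [NormedSpace ℝ E'] (f : E → E') (M : Set E) : Prop :=
  ∀ p ∈ M, ∃ U : Set E, IsOpen U ∧ p ∈ U ∧
    ∃ g : E → E', ContDiffOn ℝ ∞ g U ∧ Set.EqOn f g (M ∩ U)

/-- `F` is a symplectomorphism from `(M, Ω)` onto `(M', Ω')`: a diffeomorphism of `M` onto `M'`
with `F^* Ω' = Ω`. -/
structure IsSymplectomorphism {E E' : Type*} [NormedAddCommGroup E] [NormedSpace ℝ E]
    [NormedAddCommGroup E'] [NormedSpace ℝ E'] (M : Set E) (Ω : E → E → E → ℝ)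
    (M' : Set E') (Ω' : E' → E' → E' → ℝ) (F : E → E') : Prop where
  bijOn : Set.BijOn F M M'
  smooth : IsSmoothOn F M
  smooth_inv : ∃ G : E' → E, Set.InvOn G F M M' ∧ IsSmoothOn G M'
  pullback : ∀ p ∈ M, ∀ γ δ : ℝ → E, IsCurveThrough M p γ → IsCurveThrough M p δ →
    Ω' (F p) (deriv (F ∘ γ) 0) (deriv (F ∘ δ) 0) = Ω p (deriv γ 0) (deriv δ 0)

/-- Alternating one-forms, at a point of `E`. -/
abbrev OneForm (E : Type*) [NormedAddCommGroup E] [NormedSpace ℝ E] : Type _ :=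
  E [⋀^Fin 1]→L[ℝ] ℝ

/-- A continuous linear functional, seen as an alternating one-form. -/
def toOneForm {E : Type*} [NormedAddCommGroup E] [NormedSpace ℝ E] (l : E →L[ℝ] ℝ) : OneForm E :=
  ContinuousAlternatingMap.ofSubsingleton ℝ E ℝ (0 : Fin 1) l

theorem extDeriv_linear {E : Type*} [NormedAddCommGroup E] [NormedSpace ℝ E]
    (B : E →L[ℝ] E →L[ℝ] ℝ) (p X Y : E) :
    extDeriv (fun q => toOneForm (B q)) p ![X, Y] = B X Y - B Y X := by
  have hd : ∀ w : E, HasFDerivAt (fun q => B q w) (B.flip w) p := fun w =>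
    (B.flip w).hasFDerivAt
  have hD : DifferentiableAt ℝ (fun q => toOneForm (B q)) p :=
    (ContinuousAlternatingMap.ofSubsingletonLIE (𝕜 := ℝ) (E := E) (F := ℝ)
      (0 : Fin 1)).toContinuousLinearEquiv.toContinuousLinearMap.differentiableAt.comp p
        B.differentiableAt
  rw [extDeriv_apply hD]
  simp [toOneForm, Fin.sum_univ_two, Fin.removeNth, (hd _).fderiv, sub_eq_add_neg]

end Submanifolds

/-! ### Complex projective space as an adjoint orbit of `SU(n+1)` -/

/-- Complex `(n+1) × (n+1)` matrices. -/
abbrev Mat (n : ℕ) : Type := Matrix (Fin (n + 1)) (Fin (n + 1)) ℂ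

/-- The group `SU(n+1)`. -/
abbrev SU (n : ℕ) : Submonoid (Mat n) := Matrix.specialUnitaryGroup (Fin (n + 1)) ℂ

/-- The Lie algebra `su(n+1)`. -/
def su (n : ℕ) : Set (Mat n) := {a | aᴴ = -a ∧ a.trace = 0}

/-- The adjoint action, `Ad_g x = g x g⁻¹` (as `g⁻¹ = g^*` for unitary `g`). -/
def Ad {n : ℕ} (g x : Mat n) : Mat n := g * x * gᴴ

/-- The invariant scalar product `(X, Y) = -2 tr (X Y)` of `su(n+1)` (the trace is real there). -/
def ip (n : ℕ) : Mat n →ₗ[ℝ] Mat n →ₗ[ℝ] ℝ :=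
  LinearMap.mk₂ ℝ (fun X Y => -2 * (X * Y).trace.re)
    (fun X X' Y => by simp [add_mul]; ring)
    (fun c X Y => by simp [mul_left_comm])
    (fun X Y Y' => by simp [mul_add])
    (fun c X Y => by simp [mul_left_comm])

theorem ip_apply (n : ℕ) (X Y : Mat n) : ip n X Y = -2 * (X * Y).trace.re := rfl

/-- `Z = diag(-i, …, -i, n i) / (n + 1)`. -/
def baseZ (n : ℕ) : Mat n :=
  Matrix.diagonal fun k => if k = Fin.last n then Complex.I * n / (n + 1) else -Complex.I / (n + 1)

/-- `ℂP^n`, as the adjoint orbit of `Z`, whose stabilizer is `S(U(n) × U(1))`.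
The induced Riemannian metric is the restriction of `ip n` to tangent vectors; projective lines
are then round spheres of radius `1`, of area `4π`. -/
def CP (n : ℕ) : Set (Mat n) := {x | ∃ g ∈ SU n, x = Ad g (baseZ n)}

/-- The complex structure `j_x v = [x, v]`. -/
def J {n : ℕ} (x v : Mat n) : Mat n := x * v - v * x

/-- The Fubini-Study form `ω_x (u, w) = g (j_x u, w)`. -/
def fubiniStudy (n : ℕ) (x u w : Mat n) : ℝ := ip n (J x u) w

/-- Length on `[0, 1]` of a curve in `ℂP^n`. -/
def curveLength {n : ℕ} (γ : ℝ → Mat n) : ℝ :=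
  ∫ t in (0 : ℝ)..1, Real.sqrt (ip n (deriv γ t) (deriv γ t))

/-- The Riemannian distance of `ℂP^n`. -/
def riemDist {n : ℕ} (p q : Mat n) : ℝ :=
  sInf {L | ∃ γ : ℝ → Mat n, ContDiff ℝ 1 γ ∧ (∀ t ∈ Set.Icc (0 : ℝ) 1, γ t ∈ CP n) ∧
    γ 0 = p ∧ γ 1 = q ∧ L = curveLength γ}

/-- Geodesics of `ℂP^n`: smooth curves with acceleration normal to `ℂP^n`, which means that their
covariant acceleration vanishes. -/
def IsGeodesic {n : ℕ} (γ : ℝ → Mat n) : Prop :=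
  ContDiff ℝ ∞ γ ∧ ∀ t, γ t ∈ CP n ∧
    ∀ w ∈ tangentVectors (CP n) (γ t), ip n (iteratedDeriv 2 γ t) w = 0

/-! ### The two symplectic manifolds -/

/-- The disc bundle `D_ρ ℂP^n` of pairs `(x, v)` with `v ∈ T_x ℂP^n` and `|v| < ρ`. -/
def discBundle (n : ℕ) (ρ : ℝ) : Set (Mat n × Mat n) :=
  {p | p.1 ∈ CP n ∧ p.2 ∈ tangentVectors (CP n) p.1 ∧ ip n p.2 p.2 < ρ ^ 2}

/-- The one-form `λ_{(x,v)} (ξ) = g_x (v, dπ ξ)`. -/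
def liouville (n : ℕ) (p : Mat n × Mat n) : OneForm (Mat n × Mat n) :=
  toOneForm ((ip n p.2).toContinuousLinearMap.comp (ContinuousLinearMap.fst ℝ (Mat n) (Mat n)))

/-- The twisted form `dλ - s π^* ω_FS`. -/
def magneticForm (n : ℕ) (s : ℝ) (p X Y : Mat n × Mat n) : ℝ :=
  extDeriv (liouville n) p ![X, Y] - s * fubiniStudy n p.1 X.1 Y.1

theorem magneticForm_eq (n : ℕ) (s : ℝ) (p X Y : Mat n × Mat n) :
    magneticForm n s p X Y =
      ip n X.2 Y.1 - ip n Y.2 X.1 - s * fubiniStudy n p.1 X.1 Y.1 := by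
  have h := extDeriv_linear ((ContinuousLinearMap.compL ℝ (Mat n × Mat n) (Mat n) ℝ).flip
    (ContinuousLinearMap.fst ℝ (Mat n) (Mat n)) ∘L
      (ip n).toContinuousBilinearMap ∘L ContinuousLinearMap.snd ℝ (Mat n) (Mat n)) p X Y
  exact congrArg (fun r : ℝ => r - s * fubiniStudy n p.1 X.1 Y.1) h

/-- The complement in `ℂP^n × ℂP^n` of the anti-diagonal divisor, which consists of the pairs
`(p, q)` at maximal distance. -/
def offAntidiagonal (n : ℕ) : Set (Mat n × Mat n) :=
  (CP n ×ˢ CP n) \ {p | ∀ a ∈ CP n, ∀ b ∈ CP n, riemDist a b ≤ riemDist p.1 p.2}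

/-- The form `R₁ ω_FS ⊖ R₂ ω_FS = R₁ pr₁^* ω_FS - R₂ pr₂^* ω_FS`. -/
def productForm (n : ℕ) (R₁ R₂ : ℝ) (p X Y : Mat n × Mat n) : ℝ :=
  R₁ * fubiniStudy n p.1 X.1 Y.1 - R₂ * fubiniStudy n p.2 X.2 Y.2

/-! ### The actions of `SU(n+1)` -/

/-- The diagonal action on `ℂP^n × ℂP^n`.  As `Ad_g` is linear, the same formula is the action
`(x, v) ↦ (Ad_g x, d(Ad_g)_x v)` on the tangent bundle of `ℂP^n`. -/
def diagAct {n : ℕ} (g : Mat n) (p : Mat n × Mat n) : Mat n × Mat n := (Ad g p.1, Ad g p.2)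

/-- The value at `p` of the vector field generated by `a ∈ su(n+1)`. -/
def fundamentalField {n : ℕ} (a : Mat n) (p : Mat n × Mat n) : Mat n × Mat n :=
  deriv (fun t : ℝ => diagAct (NormedSpace.exp (t • a)) p) 0

/-- `μ : M → su(n+1)` is a moment map for the action of `SU(n+1)` on `(M, Ω)`, where the dual of
`su(n+1)` is identified with `su(n+1)` through the invariant scalar product:
`μ` is smooth, equivariant, and `Ω (a^#, ·) = d (μ, a)` for all `a ∈ su(n+1)`. -/
structure IsMomentMap {n : ℕ} (M : Set (Mat n × Mat n))
    (Ω : Mat n × Mat n → Mat n × Mat n → Mat n × Mat n → ℝ)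
    (μ : Mat n × Mat n → Mat n) : Prop where
  smooth : IsSmoothOn μ M
  mem_su : ∀ p ∈ M, μ p ∈ su n
  equivariant : ∀ g ∈ SU n, ∀ p ∈ M, μ (diagAct g p) = Ad g (μ p)
  hamiltonian : ∀ a ∈ su n, ∀ p ∈ M, ∀ γ : ℝ → Mat n × Mat n, IsCurveThrough M p γ →
    Ω p (fundamentalField a p) (deriv γ 0) = deriv (fun t => ip n (μ (γ t)) a) 0

end CPn

end

noncomputable section

namespace CPn

variable {n : ℕ}

/-! ### The bracket and the scalar product -/

/-! A point of `CP n` is x = i(P - 1/(n+1)) with P a projection of rank one, and v is tangent at x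
exactly when it is skew-Hermitian and ad_x² v = -v. For such v the geodesic with initial velocity
[x, v] is Ad(exp(-tv)) x. As ad_v² [x, v] = -|v|² [x, v] (`J_J_J`), it stays in the span of x, [x,
v], [v, [x, v]] (`geod_eq`), and `turn` gives its points by coefficients k = (1 - cos α)/r² and m =
(sin α)/r, where r = |v|.

The moment maps dictate F. They are -[x, v] - s x on the disc bundle and R₁ x₁ - R₂ x₂ on the
product. If x₁, x₂ lie on this geodesic at angles -α₁, α₂, the two agree as soon as R₁ exp(iα₁) - R₂
exp(-iα₂) = -s + ir. Since 4 R₁ R₂ = 1 and R₁ + R₂ = √(s²+1), taking absolute values gives cos(α₁ +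
α₂) = 1 - 2r². The solution is rational in ρ = √(1 - r²) (`kCoeff`, `mCoeff`), hence smooth for r <
1, also at the zero section. Then tr(P₁P₂) = ρ² and [x₁, x₂] = -2ρ v, so v can be read off from the
pair, and x is recovered by rotating x₁ back; this is the inverse `fromPair`.

The pullback needs almost no differentiation of F. Equivariance and the equality of the moment maps
force both two-forms to agree once one argument is a fundamental vector. The orbits cover all
directions of the base, and off the zero section all vertical directions but that of v, on which an
alternating form vanishes (`exists_fundamental_vertical`). On the zero section the vertical vectors
are checked directly (`pullback_vertical`).

The image is identified through the overlap tr(PQ), which is cos² of half the distance: the maximal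
distance is π, attained exactly when the overlap is zero (`mem_offAntidiagonal`). -/

theorem J_add_right (x v w : Mat n) : J x (v + w) = J x v + J x w := by
  simp only [J]; noncomm_ring

theorem J_neg_right (x v : Mat n) : J x (-v) = -J x v := by
  simp only [J]; noncomm_ring

theorem J_neg_left (x v : Mat n) : J (-x) v = -J x v := by
  simp only [J]; noncomm_ring

theorem J_sub_right (x v w : Mat n) : J x (v - w) = J x v - J x w := by
  simp only [J]; noncomm_ring

theorem J_sub_left (x y v : Mat n) : J (x - y) v = J x v - J y v := by
  simp only [J]; noncomm_ring

theorem J_smul_right (c : ℝ) (x v : Mat n) : J x (c • v) = c • J x v := by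
  simp only [J, mul_smul_comm, smul_mul_assoc, smul_sub]

theorem J_smul_left (c : ℝ) (x v : Mat n) : J (c • x) v = c • J x v := by
  simp only [J, mul_smul_comm, smul_mul_assoc, smul_sub]

theorem J_self (x : Mat n) : J x x = 0 := by simp [J]

theorem J_zero_right (x : Mat n) : J x 0 = 0 := by simp [J]

theorem J_skew (x v : Mat n) : J x v = -J v x := by simp [J]

theorem J_jacobi (a b c : Mat n) : J a (J b c) = J (J a b) c + J b (J a c) := by
  simp only [J]; noncomm_ring

theorem conjTranspose_J {a b : Mat n} (ha : aᴴ = -a) (hb : bᴴ = -b) : (J a b)ᴴ = -J a b := by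
  simp only [J, Matrix.conjTranspose_sub, Matrix.conjTranspose_mul, ha, hb]; noncomm_ring

theorem trace_J (a b : Mat n) : (J a b).trace = 0 := by
  simp [J, Matrix.trace_mul_comm a b]

theorem ip_comm (X Y : Mat n) : ip n X Y = ip n Y X := by
  rw [ip_apply, ip_apply, Matrix.trace_mul_comm]

theorem ip_J_left (a b c : Mat n) : ip n (J a b) c = -ip n b (J a c) := by
  simp only [ip_apply, J, sub_mul, mul_sub, Matrix.trace_sub, Complex.sub_re]
  rw [mul_assoc a b c, mul_assoc b a c, Matrix.trace_mul_comm a (b * c), mul_assoc b c a]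
  ring

theorem ip_J_right (a b c : Mat n) : ip n (J a b) c = ip n a (J b c) := by
  rw [J_skew, map_neg, LinearMap.neg_apply, ip_J_left, neg_neg]

theorem ip_self_of_skew {X : Mat n} (hX : Xᴴ = -X) : ip n X X = 2 * (X * Xᴴ).trace.re := by
  rw [hX, ip_apply]; simp

open scoped ComplexOrder in
theorem ip_self_nonneg {X : Mat n} (hX : Xᴴ = -X) : 0 ≤ ip n X X := by
  rw [ip_self_of_skew hX]
  have := (Matrix.posSemidef_self_mul_conjTranspose X).trace_nonneg
  have := (Complex.le_def.1 this).1
  simp at this ⊢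
  exact this

open scoped ComplexOrder in
theorem ip_self_eq_zero {X : Mat n} (hX : Xᴴ = -X) (h : ip n X X = 0) : X = 0 := by
  rw [ip_self_of_skew hX] at h
  have h0 := (Matrix.posSemidef_self_mul_conjTranspose X).trace_nonneg
  refine Matrix.trace_mul_conjTranspose_self_eq_zero_iff.1 (Complex.ext (by simpa using h) ?_)
  exact (Complex.le_def.1 h0).2.symm

/-- Cauchy–Schwarz, from the square of |Y|² X - (X, Y) Y. The form is definite only on
skew-Hermitian matrices. -/
theorem ip_mul_self_le {X Y : Mat n} (hX : Xᴴ = -X) (hY : Yᴴ = -Y) :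
    ip n X Y ^ 2 ≤ ip n X X * ip n Y Y := by
  by_cases h0 : ip n Y Y = 0
  · simp [ip_self_eq_zero hY h0]
  have hp : 0 < ip n Y Y := lt_of_le_of_ne (ip_self_nonneg hY) (Ne.symm h0)
  have h := ip_self_nonneg (X := ip n Y Y • X - ip n X Y • Y) (by
    simp [Matrix.conjTranspose_sub, hX, hY]; abel)
  simp only [map_sub, map_smul, LinearMap.sub_apply, LinearMap.smul_apply, smul_eq_mul,
    ip_comm Y X] at h
  have h' : 0 ≤ ip n Y Y * (ip n X X * ip n Y Y - ip n X Y ^ 2) := by linarith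
  linarith [nonneg_of_mul_nonneg_right h' hp]

/-! ### The adjoint action of unitary matrices -/

theorem Ad_J {g : Mat n} (hg : gᴴ * g = 1) (x v : Mat n) : J (Ad g x) (Ad g v) = Ad g (J x v) := by
  have h : ∀ a b : Mat n, Ad g a * Ad g b = Ad g (a * b) := fun a b => by
    simp only [Ad, mul_assoc]
    rw [← mul_assoc gᴴ g, hg, one_mul]
  simp only [J, h]
  simp only [Ad, mul_sub, sub_mul]

theorem ip_Ad {g : Mat n} (hg : gᴴ * g = 1) (x v : Mat n) : ip n (Ad g x) (Ad g v) = ip n x v := by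
  simp only [ip_apply, Ad]
  rw [show g * x * gᴴ * (g * v * gᴴ) = g * (x * (gᴴ * g) * v * gᴴ) by noncomm_ring,
    Matrix.trace_mul_comm, hg, mul_one, mul_assoc _ gᴴ, hg, mul_one]

theorem Ad_sub (g x y : Mat n) : Ad g (x - y) = Ad g x - Ad g y := by simp [Ad, mul_sub, sub_mul]

theorem Ad_neg (g x : Mat n) : Ad g (-x) = -Ad g x := by simp [Ad]

theorem Ad_smul (c : ℝ) (g x : Mat n) : Ad g (c • x) = c • Ad g x := by simp [Ad]

theorem Ad_mul (g h x : Mat n) : Ad (g * h) x = Ad g (Ad h x) := by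
  simp [Ad, Matrix.conjTranspose_mul, mul_assoc]

theorem conjTranspose_Ad (g x : Mat n) : (Ad g x)ᴴ = Ad g xᴴ := by
  simp [Ad, Matrix.conjTranspose_mul, mul_assoc]

theorem conjTranspose_mul_self_of_mem_SU {g : Mat n} (hg : g ∈ SU n) : gᴴ * g = 1 :=
  Matrix.mem_unitaryGroup_iff'.1 (Matrix.mem_specialUnitaryGroup_iff.1 hg).1

/-- Conjugation by a unitary matrix preserves `CP n`: the determinant may be corrected by a
diagonal phase, which commutes with `baseZ n`. -/
theorem Ad_baseZ_mem {g : Mat n} (hg : gᴴ * g = 1) : Ad g (baseZ n) ∈ CP n := by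
  have hd : star g.det * g.det = 1 := by
    rw [← Matrix.det_conjTranspose, ← Matrix.det_mul, hg, Matrix.det_one]
  set d : Fin (n + 1) → ℂ := fun k => if k = Fin.last n then star g.det else 1 with hdd
  have hds : (Matrix.diagonal d)ᴴ = Matrix.diagonal (star d) := Matrix.diagonal_conjTranspose d
  have h1 : star d * d = 1 := by
    funext k
    by_cases hk : k = Fin.last n
    · simpa [hdd, hk, mul_comm] using hd
    · simp [hdd, hk]
  have hu : (Matrix.diagonal d)ᴴ * Matrix.diagonal d = (1 : Mat n) := by
    rw [hds, Matrix.diagonal_mul_diagonal]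
    exact (congrArg Matrix.diagonal h1).trans Matrix.diagonal_one
  have hdet : (Matrix.diagonal d).det = star g.det := by
    rw [Matrix.det_diagonal, Fin.prod_univ_castSucc]
    simp [hdd, (Fin.castSucc_lt_last _).ne]
  refine ⟨g * Matrix.diagonal d, Matrix.mem_specialUnitaryGroup_iff.2
    ⟨Matrix.mem_unitaryGroup_iff'.2 ?_, ?_⟩, ?_⟩
  · rw [Matrix.star_eq_conjTranspose, Matrix.conjTranspose_mul,
      show (Matrix.diagonal d)ᴴ * gᴴ * (g * Matrix.diagonal d) =
        (Matrix.diagonal d)ᴴ * (gᴴ * g) * Matrix.diagonal d by noncomm_ring, hg, mul_one, hu]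
  · rw [Matrix.det_mul, hdet, mul_comm, hd]
  · rw [Ad_mul]
    congr 1
    have hu' : Matrix.diagonal d * (Matrix.diagonal d)ᴴ = (1 : Mat n) := mul_eq_one_comm.1 hu
    have hc : Matrix.diagonal d * baseZ n = baseZ n * Matrix.diagonal d := by
      simp only [baseZ, Matrix.diagonal_mul_diagonal, mul_comm]
    rw [Ad, hc, mul_assoc, hu', mul_one]

theorem Ad_mem_CP {g x : Mat n} (hg : gᴴ * g = 1) (hx : x ∈ CP n) : Ad g x ∈ CP n := by
  obtain ⟨h, hh, rfl⟩ := hx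
  rw [← Ad_mul]
  refine Ad_baseZ_mem ?_
  have := conjTranspose_mul_self_of_mem_SU hh
  rw [Matrix.conjTranspose_mul, show hᴴ * gᴴ * (g * h) = hᴴ * (gᴴ * g) * h by noncomm_ring, hg,
    mul_one, this]

theorem Ad_conjTranspose_Ad {g : Mat n} (hg : gᴴ * g = 1) (x : Mat n) : Ad gᴴ (Ad g x) = x := by
  simp only [Ad, Matrix.conjTranspose_conjTranspose, mul_assoc, hg, mul_one]
  rw [← mul_assoc, hg, one_mul]

/-! ### Points of `CP n` as projections of rank one -/

/-- Orthogonal projections of rank one. -/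
structure IsRankOneProj (P : Mat n) : Prop where
  herm : Pᴴ = P
  idem : P * P = P
  trace_one : P.trace = 1
  sandwich : ∀ M, P * M * P = (P * M).trace • P

theorem isRankOneProj_of_col {u : Matrix (Fin (n + 1)) (Fin 1) ℂ} (hu : uᴴ * u = 1) :
    IsRankOneProj (u * uᴴ) where
  herm := by simp [Matrix.conjTranspose_mul]
  idem := by
    rw [Matrix.mul_assoc, ← Matrix.mul_assoc uᴴ, hu, Matrix.one_mul]
  trace_one := by rw [Matrix.trace_mul_comm, hu]; simp
  sandwich M := by
    have h1 : ∀ c : Matrix (Fin 1) (Fin 1) ℂ, c = c.trace • 1 := fun c => by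
      ext i j
      fin_cases i; fin_cases j
      simp [Matrix.trace]
    have h2 : uᴴ * M * u = (u * uᴴ * M).trace • 1 := by
      rw [h1 (uᴴ * M * u), Matrix.trace_mul_comm, ← Matrix.mul_assoc]
    calc u * uᴴ * M * (u * uᴴ) = u * (uᴴ * M * u) * uᴴ := by simp only [Matrix.mul_assoc]
      _ = _ := by rw [h2]; simp

/-- The point of `CP n` given by a projection of rank one. -/
def ofProj (P : Mat n) : Mat n := Complex.I • P - (Complex.I / (n + 1)) • (1 : Mat n)

/-- The last column of a matrix. -/
def lastCol (g : Mat n) : Matrix (Fin (n + 1)) (Fin 1) ℂ := g.submatrix id fun _ => Fin.last n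

theorem conjTranspose_lastCol_mul {g : Mat n} (hg : gᴴ * g = 1) :
    (lastCol g)ᴴ * lastCol g = 1 := by
  ext i j
  fin_cases i; fin_cases j
  have := congrFun (congrFun hg (Fin.last n)) (Fin.last n)
  simpa [lastCol, Matrix.mul_apply] using this

/-- Z comes from the projection onto the last coordinate line, which g carries to the line of its
last column. -/
theorem Ad_baseZ_eq {g : Mat n} (hg : gᴴ * g = 1) :
    Ad g (baseZ n) = ofProj (lastCol g * (lastCol g)ᴴ) := by
  have hg2 : g * gᴴ = 1 := mul_eq_one_comm.1 hg
  have hE : baseZ n = ofProj (Matrix.diagonal fun k => if k = Fin.last n then 1 else 0) := by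
    ext i j
    by_cases hij : i = j
    · subst hij
      have : (n : ℂ) + 1 ≠ 0 := by exact_mod_cast Nat.succ_ne_zero n
      by_cases hi : i = Fin.last n
      · simp [baseZ, ofProj, hi]; field_simp; ring
      · simp [baseZ, ofProj, hi]; ring
    · simp [baseZ, ofProj, hij]
  have hP : g * (Matrix.diagonal fun k => if k = Fin.last n then (1 : ℂ) else 0) * gᴴ =
      lastCol g * (lastCol g)ᴴ := by
    ext i j
    simp [lastCol, Matrix.mul_apply, Matrix.diagonal_apply]
  rw [← hP, hE]
  simp [ofProj, Ad, mul_sub, sub_mul, hg2]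

theorem exists_col {x : Mat n} (hx : x ∈ CP n) :
    ∃ u : Matrix (Fin (n + 1)) (Fin 1) ℂ, uᴴ * u = 1 ∧ x = ofProj (u * uᴴ) := by
  obtain ⟨g, hg, rfl⟩ := hx
  have hg1 := conjTranspose_mul_self_of_mem_SU hg
  exact ⟨_, conjTranspose_lastCol_mul hg1, Ad_baseZ_eq hg1⟩

theorem exists_proj {x : Mat n} (hx : x ∈ CP n) : ∃ P, IsRankOneProj P ∧ x = ofProj P := by
  obtain ⟨u, hu, h⟩ := exists_col hx
  exact ⟨_, isRankOneProj_of_col hu, h⟩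

theorem conjTranspose_ofProj {P : Mat n} (hP : IsRankOneProj P) : (ofProj P)ᴴ = -ofProj P := by
  have : star (Complex.I / ((n : ℂ) + 1)) = -(Complex.I / ((n : ℂ) + 1)) := by
    simp [neg_div]
  rw [ofProj, Matrix.conjTranspose_sub, Matrix.conjTranspose_smul, Matrix.conjTranspose_smul, this,
    hP.herm]
  simp [sub_eq_add_neg, add_comm]

theorem J_ofProj_left (P v : Mat n) : J (ofProj P) v = Complex.I • (P * v - v * P) := by
  simp only [J, ofProj, sub_mul, mul_sub, smul_mul_assoc, mul_smul_comm, one_mul, mul_one, smul_sub]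
  abel

theorem conjTranspose_of_mem_CP {x : Mat n} (hx : x ∈ CP n) : xᴴ = -x := by
  obtain ⟨P, hP, rfl⟩ := exists_proj hx
  exact conjTranspose_ofProj hP

theorem trace_of_mem_CP {x : Mat n} (hx : x ∈ CP n) : x.trace = 0 := by
  obtain ⟨P, hP, rfl⟩ := exists_proj hx
  have : (n : ℂ) + 1 ≠ 0 := by exact_mod_cast Nat.succ_ne_zero n
  simp only [ofProj, Matrix.trace_sub, Matrix.trace_smul, hP.trace_one, Matrix.trace_one]
  simp
  field_simp
  simp

theorem IsRankOneProj.trace_mul_eq {P X Y : Mat n} (hP : IsRankOneProj P) (hX : Xᴴ = -X)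
    (hY : Yᴴ = -Y) : (P * (X * Y)).trace = star (P * (Y * X)).trace := by
  rw [← Matrix.trace_conjTranspose]
  simp [Matrix.conjTranspose_mul, hP.herm, hX, hY]
  rw [Matrix.trace_mul_comm, mul_assoc]

/-- An algebraic description of the tangent vectors of `CP n` at `x`. -/
structure IsTangent (x v : Mat n) : Prop where
  skew : vᴴ = -v
  J_J : J x (J x v) = -v

theorem IsTangent.smul {x v : Mat n} (h : IsTangent x v) (c : ℝ) : IsTangent x (c • v) :=
  ⟨by simp [h.skew], by rw [J_smul_right, J_smul_right, h.J_J, smul_neg]⟩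

theorem IsTangent.Ad {g x v : Mat n} (h : IsTangent x v) (hg : gᴴ * g = 1) :
    IsTangent (Ad g x) (Ad g v) :=
  ⟨by rw [conjTranspose_Ad, h.skew, Ad_neg], by rw [Ad_J hg, Ad_J hg, h.J_J, Ad_neg]⟩

theorem IsTangent.J {x v : Mat n} (h : IsTangent x v) (hx : x ∈ CP n) : IsTangent x (J x v) :=
  ⟨conjTranspose_J (conjTranspose_of_mem_CP hx) h.skew, by rw [h.J_J, J_neg_right]⟩

/-- Written with P, ad_x² v = -v says v = Pv + vP - 2PvP, and multiplying by P on both sides gives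
PvP = 0. Tangent vectors are thus off-diagonal for the splitting into image and kernel of P. -/
theorem IsTangent.sandwich {P v : Mat n} (hP : IsRankOneProj P) (h : IsTangent (ofProj P) v) :
    P * v * P = 0 ∧ v = P * v + v * P := by
  have h1 : P * v - P * v * P - (P * v * P - v * P) = v := by
    have := h.J_J
    simp only [J_ofProj_left, mul_smul_comm, smul_mul_assoc, mul_sub, sub_mul, ← mul_assoc,
      hP.idem, smul_sub, smul_smul, Complex.I_mul_I, neg_smul, one_smul] at this
    rw [mul_assoc v P P, hP.idem] at this
    rw [← neg_inj, ← this]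
    abel
  have h2 : P * v * P = 0 := by
    have := congrArg (fun M => P * M * P) h1
    simp only [mul_sub, sub_mul, ← mul_assoc, hP.idem] at this
    simp only [mul_assoc, hP.idem] at this
    simpa [mul_assoc] using this.symm
  exact ⟨h2, by rw [h2] at h1; simpa using h1.symm⟩

/-- A product of two off-diagonal matrices is block diagonal, and its block on the line of P is a
scalar. -/
theorem IsTangent.proj_mul {P v Y : Mat n} (hP : IsRankOneProj P) (hv : IsTangent (ofProj P) v)
    (hY : IsTangent (ofProj P) Y) : P * (v * Y) = (P * (v * Y)).trace • P ∧
      v * Y * P = (P * (v * Y)).trace • P := by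
  obtain ⟨hv0, hv1⟩ := hv.sandwich hP
  obtain ⟨hY0, hY1⟩ := hY.sandwich hP
  rw [← hP.sandwich]
  constructor
  · nth_rw 1 [hY1]
    rw [mul_add, mul_add, ← mul_assoc v P Y, ← mul_assoc P, ← mul_assoc P v P, hv0]
    noncomm_ring
  · nth_rw 1 [hv1]
    rw [add_mul, add_mul, mul_assoc v P Y, mul_assoc v (P * Y) P, hY0]
    noncomm_ring

theorem IsTangent.ip_eq {P v Y : Mat n} (hP : IsRankOneProj P) (hv : IsTangent (ofProj P) v)
    (hY : IsTangent (ofProj P) Y) : ip n v Y = -4 * (P * (v * Y)).trace.re := by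
  obtain ⟨hv0, hv1⟩ := hv.sandwich hP
  have h : v * Y = P * (v * Y) + v * P * Y := by
    nth_rw 1 [hv1]
    noncomm_ring
  have h2 : (v * P * Y).trace = star (P * (v * Y)).trace := by
    rw [hP.trace_mul_eq hv.skew hY.skew, star_star, mul_assoc, Matrix.trace_mul_comm, mul_assoc]
  have h3 := congrArg (fun M => M.trace.re) h
  simp only [Matrix.trace_add, h2] at h3
  rw [ip_apply, h3]
  simp
  ring

/-- The curvature tensor of `CP n`, paired with a vector twice. -/
theorem curvature {x v Y : Mat n} (hx : x ∈ CP n) (hv : IsTangent x v) (hY : IsTangent x Y) :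
    ∃ b : ℝ, J (J v Y) v = (-(ip n v Y / 4)) • v + b • J x v + (ip n v v / 4) • Y := by
  obtain ⟨P, hP, rfl⟩ := exists_proj hx
  obtain ⟨hv0, hv1⟩ := hv.sandwich hP
  obtain ⟨hY0, hY1⟩ := hY.sandwich hP
  obtain ⟨a1, a2⟩ := hv.proj_mul hP hY
  obtain ⟨b1, b2⟩ := hY.proj_mul hP hv
  obtain ⟨c1, c2⟩ := hv.proj_mul hP hv
  have hr := hv.ip_eq hP hv
  have hi := hv.ip_eq hP hY
  have hb := hP.trace_mul_eq hY.skew hv.skew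
  have hc := hP.trace_mul_eq hv.skew hv.skew
  set α := (P * (v * Y)).trace
  rw [hb] at b1 b2
  set τ := (P * (v * v)).trace
  have e1 : v * Y * v = α • (P * v) + star α • (v * P) := by
    calc v * Y * v = P * (v * Y) * v + v * (P * (Y * v)) := by
          nth_rw 1 [hv1]
          noncomm_ring
      _ = _ := by rw [a1, b1, smul_mul_assoc, mul_smul_comm]
  have e2 : Y * (v * v) = star α • (P * v) + τ • (Y * P) := by
    calc Y * (v * v) = P * (Y * v) * v + Y * (P * (v * v)) := by
          nth_rw 1 [hY1]
          noncomm_ring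
      _ = _ := by rw [b1, c1, smul_mul_assoc, mul_smul_comm]
  have e3 : v * v * Y = τ • (P * Y) + α • (v * P) := by
    calc v * v * Y = v * v * P * Y + v * (v * Y * P) := by
          nth_rw 1 [hY1]
          noncomm_ring
      _ = _ := by rw [a2, c2, smul_mul_assoc, mul_smul_comm]
  have hτ : τ = ((-(ip n v v) / 4 : ℝ) : ℂ) := by
    refine Complex.ext ?_ ?_
    · rw [hr]; simp
    · have := congrArg Complex.im hc
      simp at this ⊢
      linarith
  have hα : α = ((-(ip n v Y) / 4 : ℝ) : ℂ) + (α.im : ℂ) * Complex.I := by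
    refine Complex.ext ?_ ?_
    · rw [hi]; simp
    · simp
  -- The coefficient of Pv is 2α - ᾱ = Re α + 3i Im α and that of vP is its conjugate, while i(Pv -
  -- vP) = [x, v].
  refine ⟨3 * α.im, ?_⟩
  have hα' : star α = ((-(ip n v Y) / 4 : ℝ) : ℂ) - (α.im : ℂ) * Complex.I := by
    refine Complex.ext ?_ ?_
    · rw [hi]; simp
    · simp
  have hJ : J (J v Y) v = (2 : ℂ) • (v * Y * v) - Y * (v * v) - v * v * Y := by
    simp only [J, two_smul]; noncomm_ring
  rw [hJ, e1, e2, e3, J_ofProj_left, hα', hτ]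
  generalize hβ : α.im = β at *
  generalize ip n v Y = c at *
  generalize ip n v v = d at *
  rw [hα]
  simp only [← Complex.coe_smul]
  conv_rhs => rw [hY1]
  conv_rhs => enter [1, 1]; rw [hv1]
  push_cast
  module

/-- Twice applying `ad v` multiplies `J x v` by `-|v|²`. -/
theorem J_J_J {x v : Mat n} (hx : x ∈ CP n) (hv : IsTangent x v) :
    J v (J v (J x v)) = -(ip n v v) • J x v := by
  obtain ⟨P, hP, rfl⟩ := exists_proj hx
  obtain ⟨hv0, hv1⟩ := hv.sandwich hP
  obtain ⟨c1, c2⟩ := hv.proj_mul hP hv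
  have hr := hv.ip_eq hP hv
  have hc := hP.trace_mul_eq hv.skew hv.skew
  set τ := (P * (v * v)).trace
  have hτ : τ = ((-(ip n v v) / 4 : ℝ) : ℂ) := by
    refine Complex.ext ?_ ?_
    · rw [hr]; simp
    · have := congrArg Complex.im hc
      simp at this ⊢
      linarith
  have e1 : v * v * (P * v - v * P) = τ • (P * v) - τ • (v * P) := by
    calc v * v * (P * v - v * P) = v * v * P * v - v * (v * v * P) := by noncomm_ring
      _ = _ := by rw [c2, smul_mul_assoc, mul_smul_comm]
  have e2 : v * (P * v - v * P) * v = τ • (v * P) - τ • (P * v) := by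
    calc v * (P * v - v * P) * v = v * (P * (v * v)) - v * v * P * v := by noncomm_ring
      _ = _ := by rw [c1, c2, smul_mul_assoc, mul_smul_comm]
  have e3 : (P * v - v * P) * (v * v) = τ • (P * v) - τ • (v * P) := by
    calc (P * v - v * P) * (v * v) = P * (v * v) * v - v * (P * (v * v)) := by noncomm_ring
      _ = _ := by rw [c1, smul_mul_assoc, mul_smul_comm]
  have hJ : J v (J v (Complex.I • (P * v - v * P))) = Complex.I • (v * v * (P * v - v * P) -
      (2 : ℂ) • (v * (P * v - v * P) * v) + (P * v - v * P) * (v * v)) := by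
    simp only [J, two_smul, mul_smul_comm, smul_mul_assoc, ← smul_sub]
    noncomm_ring
  rw [J_ofProj_left, hJ, e1, e2, e3, hτ]
  simp only [← Complex.coe_smul]
  push_cast
  module

/-! ### The overlap of two points -/

/-- The trace of the product of the projections belonging to `p` and `q`. -/
def overlap (p q : Mat n) : ℝ := ip n p q / 2 + 1 / (n + 1)

theorem trace_mul_proj {P Q : Mat n} (hP : IsRankOneProj P) (hQ : IsRankOneProj Q) :
    (P * Q).trace = (overlap (ofProj P) (ofProj Q) : ℂ) := by
  have h0 : (n : ℝ) + 1 ≠ 0 := by positivity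
  have h1 : (P * Q).trace.im = 0 := by
    have : (P * Q).trace = star (P * Q).trace := by
      rw [← Matrix.trace_conjTranspose, Matrix.conjTranspose_mul, hP.herm, hQ.herm,
        Matrix.trace_mul_comm]
    have := congrArg Complex.im this
    simp at this
    linarith
  have hI : Complex.I / ((n : ℂ) + 1) = ((1 / (n + 1) : ℝ) : ℂ) * Complex.I := by
    push_cast; ring
  have hn : ((Fintype.card (Fin (n + 1)) : ℕ) : ℂ) = ((n + 1 : ℝ) : ℂ) := by simp
  refine Complex.ext ?_ (by simpa using h1)
  simp only [overlap, ip_apply, ofProj, sub_mul, mul_sub, smul_mul_assoc, mul_smul_comm, one_mul,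
    mul_one, Matrix.trace_sub, Matrix.trace_smul, hP.trace_one, hQ.trace_one, Matrix.trace_one,
    smul_eq_mul, hI, hn]
  have hc : 1 / ((n : ℝ) + 1) * (n + 1) = 1 := by field_simp
  generalize 1 / ((n : ℝ) + 1) = c at *
  generalize (n : ℝ) + 1 = m at *
  simp [-Complex.ofReal_add, -Complex.ofReal_natCast]
  linear_combination -c * hc

theorem overlap_comm (p q : Mat n) : overlap p q = overlap q p := by
  rw [overlap, overlap, ip_comm]

theorem overlap_self {p : Mat n} (hp : p ∈ CP n) : overlap p p = 1 := by
  obtain ⟨P, hP, rfl⟩ := exists_proj hp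
  have := trace_mul_proj hP hP
  rw [hP.idem, hP.trace_one] at this
  exact_mod_cast this.symm

open scoped ComplexOrder in
theorem overlap_nonneg {p q : Mat n} (hp : p ∈ CP n) (hq : q ∈ CP n) : 0 ≤ overlap p q := by
  obtain ⟨P, hP, rfl⟩ := exists_proj hp
  obtain ⟨Q, hQ, rfl⟩ := exists_proj hq
  have h := (Matrix.posSemidef_self_mul_conjTranspose (P * Q)).trace_nonneg
  rw [Matrix.conjTranspose_mul, hP.herm, hQ.herm, mul_assoc, ← mul_assoc Q, hQ.idem,
    Matrix.trace_mul_comm, mul_assoc, hP.idem, Matrix.trace_mul_comm, trace_mul_proj hP hQ] at h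
  exact_mod_cast h

/-- The bracket of a point with a skew-Hermitian matrix is a tangent vector. -/
theorem isTangent_J {p a : Mat n} (hp : p ∈ CP n) (ha : aᴴ = -a) : IsTangent p (J p a) := by
  refine ⟨conjTranspose_J (conjTranspose_of_mem_CP hp) ha, ?_⟩
  obtain ⟨P, hP, rfl⟩ := exists_proj hp
  have h1 : P * (P * (P * a - a * P) - (P * a - a * P) * P) -
      (P * (P * a - a * P) - (P * a - a * P) * P) * P = P * a - a * P := by
    have e1 : ∀ M, P * (P * M) = P * M := fun M => by rw [← mul_assoc, hP.idem]
    simp only [mul_sub, sub_mul, mul_assoc, hP.idem, e1]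
    noncomm_ring
  simp only [J_ofProj_left, mul_smul_comm, smul_mul_assoc, ← smul_sub, h1, smul_smul,
    Complex.I_mul_I]
  simp

theorem J_ofProj (P Q : Mat n) : J (ofProj P) (ofProj Q) = Q * P - P * Q := by
  rw [J_ofProj_left]
  simp only [ofProj, mul_sub, sub_mul, mul_smul_comm, smul_mul_assoc, one_mul, mul_one, smul_sub,
    smul_smul, Complex.I_mul_I]
  simp only [neg_smul, one_smul]
  abel

theorem proj_mul_proj {P Q : Mat n} (hP : IsRankOneProj P) (hQ : IsRankOneProj Q) :
    P * Q * P = (overlap (ofProj P) (ofProj Q) : ℂ) • P := by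
  rw [hP.sandwich, trace_mul_proj hP hQ]

/-- Follows from PQP = τP and QPQ = τQ. With τ the squared cosine of half the distance, this is the
squared sine of the distance. -/
theorem ip_J_J {p q : Mat n} (hp : p ∈ CP n) (hq : q ∈ CP n) :
    ip n (J p q) (J p q) = 4 * overlap p q * (1 - overlap p q) := by
  obtain ⟨P, hP, rfl⟩ := exists_proj hp
  obtain ⟨Q, hQ, rfl⟩ := exists_proj hq
  have h1 := proj_mul_proj hP hQ
  have h2 := proj_mul_proj hQ hP
  have ht := trace_mul_proj hP hQ
  rw [overlap_comm] at h2
  set τ := overlap (ofProj P) (ofProj Q)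
  have e : (Q * P - P * Q) * (Q * P - P * Q) =
      (τ : ℂ) • (Q * P) + (τ : ℂ) • (P * Q) - (τ : ℂ) • Q - (τ : ℂ) • P := by
    calc (Q * P - P * Q) * (Q * P - P * Q) =
        Q * P * Q * P + P * Q * P * Q - Q * (P * P) * Q - P * (Q * Q) * P := by noncomm_ring
      _ = _ := by rw [hP.idem, hQ.idem, h1, h2, smul_mul_assoc, smul_mul_assoc]
  rw [J_ofProj, ip_apply, e]
  simp only [Matrix.trace_sub, Matrix.trace_add, Matrix.trace_smul, hP.trace_one, hQ.trace_one,
    Matrix.trace_mul_comm Q P, ht]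
  simp
  ring

theorem overlap_le_one {p q : Mat n} (hp : p ∈ CP n) (hq : q ∈ CP n) : overlap p q ≤ 1 := by
  have h1 := ip_self_nonneg (conjTranspose_J (conjTranspose_of_mem_CP hp)
    (conjTranspose_of_mem_CP hq))
  rw [ip_J_J hp hq] at h1
  nlinarith

/-- The point `q` in terms of `p` and of the tangent vector `J p q`. -/
theorem overlap_smul_eq {p q : Mat n} (hp : p ∈ CP n) (hq : q ∈ CP n) :
    (2 * overlap p q) • q = (2 * overlap p q) • p -
      J (J p q) (J p (J p q)) - (2 * overlap p q) • J p (J p q) := by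
  obtain ⟨P, hP, rfl⟩ := exists_proj hp
  obtain ⟨Q, hQ, rfl⟩ := exists_proj hq
  have h1 := proj_mul_proj hP hQ
  have h2 := proj_mul_proj hQ hP
  rw [overlap_comm] at h2
  rw [J_ofProj]
  set τ := overlap (ofProj P) (ofProj Q)
  have e1 : P * (Q * P - P * Q) - (Q * P - P * Q) * P = (2 * τ : ℂ) • P - P * Q - Q * P := by
    calc _ = (2 : ℂ) • (P * Q * P) - P * P * Q - Q * (P * P) := by rw [two_smul]; noncomm_ring
      _ = _ := by rw [hP.idem, h1, smul_smul]
  have e2 : (Q * P - P * Q) * ((2 * τ : ℂ) • P - P * Q - Q * P) -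
      ((2 * τ : ℂ) • P - P * Q - Q * P) * (Q * P - P * Q) =
      (2 * τ : ℂ) • (Q * P + P * Q + P - Q - (2 * τ : ℂ) • P) := by
    calc _ = (2 * τ : ℂ) • (Q * (P * P) - (2 : ℂ) • (P * Q * P) + P * P * Q) +
          (2 : ℂ) • (P * (Q * Q) * P) - (2 : ℂ) • (Q * (P * P) * Q) := by
            simp only [mul_sub, sub_mul, mul_smul_comm, smul_mul_assoc, mul_assoc]
            module
      _ = _ := by
            rw [hP.idem, hQ.idem, h1, h2]
            module
  rw [J_ofProj_left, e1]
  simp only [J, mul_smul_comm, smul_mul_assoc, ← smul_sub, e2]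
  simp only [ofProj, ← Complex.coe_smul]
  push_cast
  module

/-! ### Brackets of `x`, `v`, `J x v` and `J v (J x v)` -/

section Relations

variable {x v : Mat n}

/-- By Jacobi and J² = -1. A matrix commuting with x is orthogonal to the tangent space at x, which
is why [v, [x, v]] is normal to the orbit. -/
theorem J_base_normal (hv : IsTangent x v) : J x (J v (J x v)) = 0 := by
  rw [J_jacobi, hv.J_J, J_self, J_neg_right, J_self]; simp

theorem J_J_normal (hx : x ∈ CP n) (hv : IsTangent x v) :
    J (J x v) (J v (J x v)) = ip n v v • v := by
  have h := J_jacobi x v (J v (J x v))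
  rw [J_J_J hx hv, J_base_normal hv, J_zero_right, J_smul_right, hv.J_J, add_zero] at h
  rw [← h, neg_smul_neg]

theorem ip_tangent_base (hv : IsTangent x v) : ip n x v = 0 := by
  rw [← neg_neg v, ← hv.J_J, map_neg, ← ip_J_right, J_self]; simp

theorem ip_J_tangent (hv : IsTangent x v) (w : Mat n) : ip n (J x v) (J x w) = ip n v w := by
  rw [← neg_neg (ip n (J x v) (J x w)), ← ip_J_left, hv.J_J]; simp

theorem ip_base_normal (hv : IsTangent x v) : ip n x (J v (J x v)) = ip n v v := by
  rw [← ip_J_right, ip_J_tangent hv]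

theorem ip_J_J_normal (x v : Mat n) : ip n (J x v) (J v (J x v)) = 0 := by
  rw [ip_comm, ip_J_right, J_self, map_zero]

theorem ip_normal_normal (hx : x ∈ CP n) (hv : IsTangent x v) :
    ip n (J v (J x v)) (J v (J x v)) = ip n v v ^ 2 := by
  rw [ip_J_left, J_J_J hx hv, map_smul, ip_J_tangent hv, smul_eq_mul]; ring

theorem ip_normal_tangent (hv : IsTangent x v) {w : Mat n} (hw : IsTangent x w) :
    ip n (J v (J x v)) w = 0 := by
  rw [← neg_neg w, ← hw.J_J, map_neg, ← neg_eq_zero, neg_neg, ← neg_eq_zero, ← ip_J_left,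
    J_base_normal hv]
  simp

theorem eq_zero_of_sqrt_ip_eq_zero (hv : vᴴ = -v) (h : √(ip n v v) = 0) : v = 0 :=
  ip_self_eq_zero hv ((Real.sqrt_eq_zero (ip_self_nonneg hv)).1 h)

end Relations

/-! ### One-parameter groups and geodesics -/

theorem conjTranspose_exp_mul_exp {a : Mat n} (ha : aᴴ = -a) :
    (NormedSpace.exp a)ᴴ * NormedSpace.exp a = 1 := by
  rw [← Matrix.exp_conjTranspose, ha, Matrix.exp_neg, Matrix.nonsing_inv_mul]
  exact (Matrix.isUnit_iff_isUnit_det _).1 (Matrix.isUnit_exp a)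

theorem conjTranspose_exp_smul (a : Mat n) (t : ℝ) :
    (NormedSpace.exp (t • a))ᴴ = NormedSpace.exp (t • aᴴ) := by
  rw [← Matrix.exp_conjTranspose, Matrix.conjTranspose_smul]; simp

theorem contDiff_exp_smul (a : Mat n) : ContDiff ℝ ∞ fun t : ℝ => NormedSpace.exp (t • a) := by
  have h : ContDiff ℝ ∞ (NormedSpace.exp : Mat n → Mat n) :=
    contDiff_iff_contDiffAt.2 fun y => (NormedSpace.exp_analytic (𝕂 := ℝ) y).contDiffAt
  exact h.comp (contDiff_id.smul contDiff_const)

theorem contDiff_Ad_exp (a x : Mat n) :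
    ContDiff ℝ ∞ fun t : ℝ => Ad (NormedSpace.exp (t • a)) x := by
  simp only [Ad, conjTranspose_exp_smul]
  exact ((contDiff_exp_smul a).mul contDiff_const).mul (contDiff_exp_smul _)

theorem hasDerivAt_Ad_exp {a : Mat n} (ha : aᴴ = -a) {γ : ℝ → Mat n} {ξ : Mat n} {t : ℝ}
    (hγ : HasDerivAt γ ξ t) :
    HasDerivAt (fun t : ℝ => Ad (NormedSpace.exp (t • a)) (γ t))
      (Ad (NormedSpace.exp (t • a)) (J a (γ t) + ξ)) t := by
  simp only [Ad, conjTranspose_exp_smul, ha]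
  have h := ((hasDerivAt_exp_smul_const a t).mul hγ).mul (hasDerivAt_exp_smul_const' (-a) t)
  have key : ∀ c e₁ e₂ : Mat n, (e₁ * a * c + e₁ * ξ) * e₂ + e₁ * c * (-a * e₂) =
      e₁ * (J a c + ξ) * e₂ := fun c e₁ e₂ => by
    simp only [J]
    noncomm_ring
  exact h.congr_deriv (key _ _ _)

theorem Ad_one (x : Mat n) : Ad 1 x = x := by simp [Ad]

theorem Ad_zero_exp (a x : Mat n) : Ad (NormedSpace.exp ((0 : ℝ) • a)) x = x := by
  simp [Ad]

theorem hasDerivAt_diagAct_exp {a : Mat n} (ha : aᴴ = -a) (p : Mat n × Mat n) :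
    HasDerivAt (fun t : ℝ => diagAct (NormedSpace.exp (t • a)) p) (J a p.1, J a p.2) 0 := by
  have h : ∀ x, HasDerivAt (fun t : ℝ => Ad (NormedSpace.exp (t • a)) x) (J a x) 0 := fun x => by
    simpa [Ad_one] using hasDerivAt_Ad_exp ha (hasDerivAt_const (0 : ℝ) x)
  exact (h p.1).prodMk (h p.2)

theorem fundamentalField_eq {a : Mat n} (ha : aᴴ = -a) (p : Mat n × Mat n) :
    fundamentalField a p = (J a p.1, J a p.2) :=
  (hasDerivAt_diagAct_exp ha p).deriv

/-- The projection belonging to a point of `CP n`. -/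
def toProj (x : Mat n) : Mat n := -Complex.I • x + (1 / (n + 1) : ℂ) • (1 : Mat n)

theorem toProj_ofProj (P : Mat n) : toProj (ofProj P) = P := by
  simp only [toProj, ofProj, smul_sub, smul_smul]
  rw [show -Complex.I * Complex.I = 1 by simp,
    show -Complex.I * (Complex.I / (n + 1)) = 1 / ((n : ℂ) + 1) by
      rw [mul_div_assoc']; simp]
  simp

/-- Differentiating P² = P gives ξ = ξP + Pξ, hence PξP = 0, which is the off-diagonal form of ad_x²
ξ = -ξ. -/
theorem isTangent_of_hasDerivAt {γ : ℝ → Mat n} {ξ : Mat n} {t : ℝ} (h : HasDerivAt γ ξ t)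
    (hγ : ∀ᶠ u in 𝓝 t, γ u ∈ CP n) : IsTangent (γ t) ξ := by
  have h1 : HasDerivAt (fun u => (γ u)ᴴ) ξᴴ t := h.star
  have h2 : HasDerivAt (fun u => -γ u) ξᴴ t :=
    h1.congr_of_eventuallyEq (hγ.mono fun u hu => (conjTranspose_of_mem_CP hu).symm)
  refine ⟨h2.unique h.neg, ?_⟩
  have h3 : HasDerivAt (fun u => toProj (γ u)) (-Complex.I • ξ) t :=
    (h.const_smul (-Complex.I)).add_const _
  have h4 : HasDerivAt (fun u => toProj (γ u))
      (-Complex.I • ξ * toProj (γ t) + toProj (γ t) * (-Complex.I • ξ)) t :=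
    (h3.mul h3).congr_of_eventuallyEq (hγ.mono fun u hu => by
      obtain ⟨P, hP, h⟩ := exists_proj hu
      simp [h, toProj_ofProj, hP.idem])
  have h5 := h3.unique h4
  obtain ⟨P, hP, hx⟩ := exists_proj hγ.self_of_nhds
  rw [hx, toProj_ofProj, smul_mul_assoc, mul_smul_comm, ← smul_add] at h5
  have h6 : ξ = ξ * P + P * ξ := smul_right_injective _ (by simp) h5
  have h7 : P * ξ * P = 0 := by
    have := congrArg (fun M => P * M * P) h6
    simp only [mul_add, add_mul, mul_assoc, hP.idem] at this
    rw [← mul_assoc P P, hP.idem] at this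
    simpa [mul_assoc] using this
  rw [hx, J_ofProj_left, J_ofProj_left]
  simp only [mul_smul_comm, smul_mul_assoc, ← smul_sub, smul_smul, Complex.I_mul_I]
  rw [neg_smul, one_smul]
  congr 1
  calc P * (P * ξ - ξ * P) - (P * ξ - ξ * P) * P =
      P * P * ξ - 2 • (P * ξ * P) + ξ * (P * P) := by noncomm_ring
    _ = P * ξ + ξ * P := by rw [hP.idem, h7]; simp
    _ = ξ := by rw [add_comm (P * ξ)]; exact h6.symm

theorem isCurveThrough_of_eventually {E : Type*} [NormedAddCommGroup E] [NormedSpace ℝ E]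
    {M : Set E} {p : E} {γ : ℝ → E} (h0 : γ 0 = p) (hs : ContDiff ℝ ∞ γ)
    (hM : ∀ᶠ t in 𝓝 0, γ t ∈ M) : IsCurveThrough M p γ := by
  obtain ⟨ε, hε, h⟩ := Metric.eventually_nhds_iff.1 hM
  refine ⟨h0, ε, hε, hs.contDiffOn, fun t ht => h ?_⟩
  rw [Real.dist_eq, sub_zero]
  exact abs_lt.2 ht

theorem IsCurveThrough.eventually_mem {E : Type*} [NormedAddCommGroup E] [NormedSpace ℝ E]
    {M : Set E} {p : E} {γ : ℝ → E} (h : IsCurveThrough M p γ) : ∀ᶠ t in 𝓝 0, γ t ∈ M := by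
  obtain ⟨-, ε, hε, -, h⟩ := h
  exact Filter.eventually_of_mem (Ioo_mem_nhds (neg_lt_zero.2 hε) hε) h

theorem IsCurveThrough.hasDerivAt {E : Type*} [NormedAddCommGroup E] [NormedSpace ℝ E]
    {M : Set E} {p : E} {γ : ℝ → E} (h : IsCurveThrough M p γ) :
    HasDerivAt γ (deriv γ 0) 0 := by
  obtain ⟨-, ε, hε, h, -⟩ := h
  exact ((h.contDiffAt (Ioo_mem_nhds (neg_lt_zero.2 hε) hε)).differentiableAt
    (by simp)).hasDerivAt

theorem mem_tangentVectors_CP {x v : Mat n} (hx : x ∈ CP n) :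
    v ∈ tangentVectors (CP n) x ↔ IsTangent x v := by
  constructor
  · rintro ⟨γ, hγ, rfl⟩
    have := isTangent_of_hasDerivAt hγ.hasDerivAt hγ.eventually_mem
    rwa [hγ.1] at this
  · intro hv
    -- The one-parameter group of [x, v] moves x with velocity [[x, v], x] = v.
    have ha : (J x v)ᴴ = -J x v := (hv.J hx).skew
    refine ⟨fun t : ℝ => Ad (NormedSpace.exp (t • J x v)) x, isCurveThrough_of_eventually
      (Ad_zero_exp _ _) (contDiff_Ad_exp _ _) (Filter.Eventually.of_forall fun t => ?_), ?_⟩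
    · exact Ad_mem_CP (conjTranspose_exp_mul_exp (by simp [ha])) hx
    · have := hasDerivAt_Ad_exp ha (hasDerivAt_const (0 : ℝ) x)
      rw [this.deriv, Ad_zero_exp, add_zero, J_skew, hv.J_J, neg_neg]

theorem mem_discBundle {p : Mat n × Mat n} :
    p ∈ discBundle n 1 ↔ p.1 ∈ CP n ∧ IsTangent p.1 p.2 ∧ ip n p.2 p.2 < 1 := by
  change _ ∧ _ ∧ _ ↔ _
  rw [one_pow]
  exact and_congr_right fun h => and_congr_left fun _ => mem_tangentVectors_CP h

/-- The geodesic with initial velocity `J x v`. -/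
def geod (x v : Mat n) (t : ℝ) : Mat n := Ad (NormedSpace.exp (t • -v)) x

theorem geod_zero (x v : Mat n) : geod x v 0 = x := Ad_zero_exp _ _

theorem conjTranspose_smul_neg {v : Mat n} (hv : vᴴ = -v) (t : ℝ) :
    (t • -v)ᴴ = -(t • -v) := by simp [hv]

theorem geod_mem {x v : Mat n} (hx : x ∈ CP n) (hv : vᴴ = -v) (t : ℝ) : geod x v t ∈ CP n :=
  Ad_mem_CP (conjTranspose_exp_mul_exp (conjTranspose_smul_neg hv t)) hx

theorem hasDerivAt_geod {x v : Mat n} (hv : vᴴ = -v) (t : ℝ) :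
    HasDerivAt (geod x v) (Ad (NormedSpace.exp (t • -v)) (J x v)) t := by
  have := hasDerivAt_Ad_exp (a := -v) (by rw [Matrix.conjTranspose_neg, hv]) (hasDerivAt_const t x)
  rwa [add_zero, J_neg_left, ← J_skew] at this

/-- The acceleration at time t is the image of -[v, [x, v]] under an isometry preserving `CP n`, so
normality need only be known at x. -/
theorem isGeodesic_geod {x v : Mat n} (hx : x ∈ CP n) (hv : IsTangent x v) :
    IsGeodesic (geod x v) := by
  refine ⟨contDiff_Ad_exp _ _, fun t => ⟨geod_mem hx hv.skew t, fun w hw => ?_⟩⟩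
  set g := NormedSpace.exp (t • -v) with hgd
  have hg : gᴴ * g = 1 := conjTranspose_exp_mul_exp (conjTranspose_smul_neg hv.skew t)
  have hg' : gᴴᴴ * gᴴ = 1 := by
    rw [Matrix.conjTranspose_conjTranspose]; exact mul_eq_one_comm.1 hg
  rw [mem_tangentVectors_CP (geod_mem hx hv.skew t)] at hw
  have hw' : IsTangent x (Ad gᴴ w) := by
    have := hw.Ad hg'
    rwa [geod, ← hgd, Ad_conjTranspose_Ad hg] at this
  have h2 : iteratedDeriv 2 (geod x v) t = Ad g (-J v (J x v)) := by
    have hdg : deriv (geod x v) = fun u : ℝ => Ad (NormedSpace.exp (u • -v)) (J x v) :=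
      funext fun u => (hasDerivAt_geod hv.skew u).deriv
    rw [iteratedDeriv_succ, iteratedDeriv_one]
    refine (congrArg (fun f => deriv f t) hdg).trans ?_
    have := hasDerivAt_Ad_exp (a := -v) (by rw [Matrix.conjTranspose_neg, hv.skew])
      (hasDerivAt_const t (J x v))
    refine this.deriv.trans ?_
    rw [add_zero, J_neg_left]
  rw [h2, ← ip_Ad hg', Ad_conjTranspose_Ad hg, map_neg, LinearMap.neg_apply,
    ip_normal_tangent hv hw', neg_zero]

/-- The right-hand side E solves the linear equation E' = -[v, E], so Ad(exp(tv)) E is constant,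
equal to x. For v = 0 the divisions by zero are harmless, as the brackets vanish. -/
theorem geod_eq {x v : Mat n} (hx : x ∈ CP n) (hv : IsTangent x v) (t : ℝ) :
    geod x v t = x - ((1 - Real.cos (t * √(ip n v v))) / ip n v v) • J v (J x v) +
      (Real.sin (t * √(ip n v v)) / √(ip n v v)) • J x v := by
  by_cases h0 : √(ip n v v) = 0
  · rw [eq_zero_of_sqrt_ip_eq_zero hv.skew h0]
    simp [geod, Ad, J_zero_right]
  set r := √(ip n v v) with hr
  have hr2 : ip n v v = r ^ 2 := (Real.sq_sqrt (ip_self_nonneg hv.skew)).symm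
  rw [hr2]
  set E : ℝ → Mat n := fun t => x - ((1 - Real.cos (t * r)) / r ^ 2) • J v (J x v) +
      (Real.sin (t * r) / r) • J x v with hE
  have hd : ∀ t, HasDerivAt E (-J v (E t)) t := fun t => by
    have h1 : HasDerivAt (fun t : ℝ => t * r) r t := by simpa using (hasDerivAt_id t).mul_const r
    have h2 := ((((h1.cos.const_sub 1).div_const (r ^ 2)).smul_const (J v (J x v))).const_sub
      x).add ((h1.sin.div_const r).smul_const (J x v))
    refine h2.congr_deriv ?_
    rw [hE]
    simp only [J_add_right, J_sub_right, J_smul_right, J_J_J hx hv, hr2]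
    rw [J_skew v x]
    match_scalars <;> field_simp
    ring
  have hc : ∀ t, Ad (NormedSpace.exp (t • v)) (E t) = x := fun t => by
    have h : ∀ t, HasDerivAt (fun t : ℝ => Ad (NormedSpace.exp (t • v)) (E t)) 0 t := fun t => by
      refine (hasDerivAt_Ad_exp hv.skew (hd t)).congr_deriv ?_
      simp [Ad]
    have := is_const_of_deriv_eq_zero (fun t => (h t).differentiableAt) (fun t => (h t).deriv) t 0
    rw [this, Ad_zero_exp]
    simp [hE]
  have hg : (NormedSpace.exp (t • v))ᴴ * NormedSpace.exp (t • v) = 1 :=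
    conjTranspose_exp_mul_exp (by simp [hv.skew])
  have := Ad_conjTranspose_Ad hg (E t)
  rw [hc, conjTranspose_exp_smul, hv.skew] at this
  exact this

/-! ### Smoothness of the algebraic operations -/

theorem contDiff_bilinear {E F G : Type*} [NormedAddCommGroup E] [NormedSpace ℝ E]
    [NormedAddCommGroup F] [NormedSpace ℝ F] [NormedAddCommGroup G] [NormedSpace ℝ G]
    (B : F →L[ℝ] F →L[ℝ] G) {f g : E → F} {m : WithTop ℕ∞}
    (hf : ContDiff ℝ m f) (hg : ContDiff ℝ m g) : ContDiff ℝ m fun e => B (f e) (g e) :=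
  (B.contDiff.comp hf).clm_apply hg

/-- The scalar product as a continuous bilinear map. -/
def ipL (n : ℕ) : Mat n →L[ℝ] Mat n →L[ℝ] ℝ := (ip n).toContinuousBilinearMap

theorem contDiff_ip {E : Type*} [NormedAddCommGroup E] [NormedSpace ℝ E] {f g : E → Mat n}
    {m : WithTop ℕ∞} (hf : ContDiff ℝ m f) (hg : ContDiff ℝ m g) :
    ContDiff ℝ m fun e => ip n (f e) (g e) :=
  contDiff_bilinear (ipL n) hf hg

theorem contDiff_J {E : Type*} [NormedAddCommGroup E] [NormedSpace ℝ E] {f g : E → Mat n}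
    {m : WithTop ℕ∞} (hf : ContDiff ℝ m f) (hg : ContDiff ℝ m g) :
    ContDiff ℝ m fun e => J (f e) (g e) :=
  (hf.mul hg).sub (hg.mul hf)

theorem hasDerivAt_ip {γ δ : ℝ → Mat n} {ξ η : Mat n} {t : ℝ} (hγ : HasDerivAt γ ξ t)
    (hδ : HasDerivAt δ η t) :
    HasDerivAt (fun u => ip n (γ u) (δ u)) (ip n (γ t) η + ip n ξ (δ t)) t :=
  ContinuousLinearMap.hasDerivAt_of_bilinear (B := ipL n) (fun _ => hγ) (fun _ => hδ)

theorem hasDerivAt_J {γ δ : ℝ → Mat n} {ξ η : Mat n} {t : ℝ} (hγ : HasDerivAt γ ξ t)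
    (hδ : HasDerivAt δ η t) :
    HasDerivAt (fun u => J (γ u) (δ u)) (J ξ (δ t) + J (γ t) η) t := by
  refine ((hγ.mul hδ).sub (hδ.mul hγ)).congr_deriv ?_
  simp only [J]
  abel

/-! ### The Riemannian distance -/

theorem curveLength_nonneg (γ : ℝ → Mat n) : 0 ≤ curveLength γ :=
  intervalIntegral.integral_nonneg zero_le_one fun _ _ => Real.sqrt_nonneg _

theorem deriv_geod {x v : Mat n} (hv : vᴴ = -v) (t : ℝ) :
    deriv (geod x v) t = Ad (NormedSpace.exp (t • -v)) (J x v) :=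
  (hasDerivAt_geod hv t).deriv

theorem riemDist_geod_le {p v : Mat n} (hp : p ∈ CP n) (hv : IsTangent p v) :
    riemDist p (geod p v 1) ≤ √(ip n v v) := by
  refine csInf_le ⟨0, ?_⟩ ⟨geod p v, (contDiff_Ad_exp _ _).of_le (by simp),
    fun t _ => geod_mem hp hv.skew t, geod_zero _ _, rfl, ?_⟩
  · rintro L ⟨γ, -, -, -, -, rfl⟩
    exact curveLength_nonneg γ
  · have h : ∀ t, ip n (deriv (geod p v) t) (deriv (geod p v) t) = ip n v v := fun t => by
      rw [deriv_geod hv.skew t,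
        ip_Ad (conjTranspose_exp_mul_exp (conjTranspose_smul_neg hv.skew t)), ip_J_tangent hv]
    simp [curveLength, h]

theorem geod_smul {p v : Mat n} (hp : p ∈ CP n) (hv : IsTangent p v) (h1 : ip n v v = 1) (θ : ℝ) :
    geod p (θ • v) 1 = p - (1 - Real.cos θ) • J v (J p v) + Real.sin θ • J p v := by
  have := geod_eq hp hv θ
  rw [h1] at this
  simp only [Real.sqrt_one, mul_one, div_one] at this
  rw [← this, geod, geod, one_smul, smul_neg]

/-- The direction is that of -[p, q], whose length is sin θ, where cos θ = 2τ - 1; positive overlap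
keeps θ below π. `overlap_smul_eq` then expresses q through p and [p, q]. -/
theorem exists_geod_of_overlap_pos {p q : Mat n} (hp : p ∈ CP n) (hq : q ∈ CP n)
    (h : 0 < overlap p q) : ∃ v, IsTangent p v ∧ √(ip n v v) < Real.pi ∧ q = geod p v 1 := by
  have hw : IsTangent p (J p q) := isTangent_J hp (conjTranspose_of_mem_CP hq)
  have hww := ip_J_J hp hq
  have hq' := overlap_smul_eq hp hq
  have hle := overlap_le_one hp hq
  set τ := overlap p q
  set w := J p q
  rcases hle.eq_or_lt with h1 | h1
  · refine ⟨0, by simpa using hw.smul 0, by simpa using Real.pi_pos, ?_⟩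
    have hw0 : w = 0 := ip_self_eq_zero hw.skew (by rw [hww, h1]; simp)
    rw [hw0] at hq'
    simp only [J_zero_right, smul_zero, sub_zero] at hq'
    rw [smul_right_injective _ (by positivity) hq']
    simp [geod, Ad]
  have hpos : 0 < 4 * τ * (1 - τ) := by have := sub_pos.2 h1; positivity
  set m := √(4 * τ * (1 - τ)) with hm
  have hm0 : 0 < m := Real.sqrt_pos.2 hpos
  have hm2 : m ^ 2 = 4 * τ * (1 - τ) := Real.sq_sqrt hpos.le
  set θ := Real.arccos (2 * τ - 1) with hθ
  have hcos : Real.cos θ = 2 * τ - 1 := Real.cos_arccos (by linarith) (by linarith)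
  have hsin : Real.sin θ = m := by
    rw [Real.sin_arccos, hm]; congr 1; ring
  have hθπ : θ < Real.pi := lt_of_le_of_ne (Real.arccos_le_pi _) fun h0 => by
    rw [h0, Real.cos_pi] at hcos; linarith
  have hv := hw.smul (-m⁻¹)
  have hv1 : ip n (-m⁻¹ • w) (-m⁻¹ • w) = 1 := by
    simp only [map_smul, LinearMap.smul_apply, smul_eq_mul, hww, ← hm2]
    field_simp
  refine ⟨θ • -m⁻¹ • w, hv.smul θ, ?_, ?_⟩
  · rw [(ip n).map_smul, LinearMap.smul_apply, (ip n (-m⁻¹ • w)).map_smul, hv1]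
    simpa [Real.sqrt_mul_self (show 0 ≤ θ from Real.arccos_nonneg _)] using hθπ
  · rw [geod_smul hp hv hv1, hcos, hsin]
    simp only [J_smul_left, J_smul_right]
    refine smul_right_injective (Mat n) (r := 2 * τ) (by positivity) ?_
    simp only [hq']
    match_scalars
    · ring
    · field_simp; rw [hm2]; ring
    · field_simp

-- Here [p, q] = 0 gives no direction, so one is built from unit vectors u, u' spanning the two
-- lines: W = u'uᴴ maps the first line isometrically to the second, and half of W - Wᴴ is a unit
-- tangent vector whose geodesic reaches q at time π.
open scoped ComplexOrder in
theorem exists_geod_of_overlap_eq_zero {p q : Mat n} (hp : p ∈ CP n) (hq : q ∈ CP n)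
    (h : overlap p q = 0) : ∃ v, IsTangent p v ∧ √(ip n v v) = Real.pi ∧ q = geod p v 1 := by
  obtain ⟨u, hu, rfl⟩ := exists_col hp
  obtain ⟨u', hu', rfl⟩ := exists_col hq
  have h0 : uᴴ * u' = 0 := by
    have h1 := proj_mul_proj (isRankOneProj_of_col hu) (isRankOneProj_of_col hu')
    rw [h] at h1
    rw [Complex.ofReal_zero, zero_smul] at h1
    have h2 : uᴴ * u' * (uᴴ * u')ᴴ = 0 := by
      calc uᴴ * u' * (uᴴ * u')ᴴ = uᴴ * u * uᴴ * (u' * u'ᴴ) * u * (uᴴ * u) := by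
            rw [hu, Matrix.conjTranspose_mul, Matrix.conjTranspose_conjTranspose, Matrix.one_mul,
              Matrix.mul_one]
            simp only [Matrix.mul_assoc]
        _ = uᴴ * (u * uᴴ * (u' * u'ᴴ) * (u * uᴴ)) * u := by simp only [Matrix.mul_assoc]
        _ = 0 := by rw [h1]; simp
    exact Matrix.self_mul_conjTranspose_eq_zero.1 h2
  have h0' : u'ᴴ * u = 0 := by
    have := congrArg Matrix.conjTranspose h0
    simpa [Matrix.conjTranspose_mul] using this
  have hP := isRankOneProj_of_col hu
  have hQ := isRankOneProj_of_col hu'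
  have eWW : u' * uᴴ * (u' * uᴴ) = 0 := by
    calc _ = u' * (uᴴ * u') * uᴴ := by simp only [Matrix.mul_assoc]
      _ = 0 := by rw [h0]; simp
  have eWW' : u' * uᴴ * (u' * uᴴ)ᴴ = u' * u'ᴴ := by
    calc _ = u' * (uᴴ * u) * u'ᴴ := by simp [Matrix.conjTranspose_mul, Matrix.mul_assoc]
      _ = _ := by rw [hu]; simp
  have eW'W : (u' * uᴴ)ᴴ * (u' * uᴴ) = u * uᴴ := by
    calc _ = u * (u'ᴴ * u') * uᴴ := by simp [Matrix.conjTranspose_mul, Matrix.mul_assoc]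
      _ = _ := by rw [hu']; simp
  have ePW : u * uᴴ * (u' * uᴴ) = 0 := by
    calc _ = u * (uᴴ * u') * uᴴ := by simp only [Matrix.mul_assoc]
      _ = 0 := by rw [h0]; simp
  have eWP : u' * uᴴ * (u * uᴴ) = u' * uᴴ := by
    calc _ = u' * (uᴴ * u) * uᴴ := by simp only [Matrix.mul_assoc]
      _ = _ := by rw [hu]; simp
  have eW'W' := congrArg Matrix.conjTranspose eWW
  have eW'P := congrArg Matrix.conjTranspose ePW
  have ePW' := congrArg Matrix.conjTranspose eWP
  generalize u * uᴴ = P at *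
  generalize u' * u'ᴴ = Q at *
  generalize u' * uᴴ = W at *
  rw [Matrix.conjTranspose_mul, hP.herm] at eW'P ePW'
  rw [Matrix.conjTranspose_mul] at eW'W'
  rw [Matrix.conjTranspose_zero] at eW'P eW'W'
  set v : Mat n := (2⁻¹ : ℝ) • (W - Wᴴ) with hvd
  have hJ : J (ofProj P) v = -(Complex.I • (2⁻¹ : ℝ) • (W + Wᴴ)) := by
    rw [J_ofProj_left, hvd]
    simp only [smul_mul_assoc, mul_smul_comm, mul_sub, sub_mul, ePW, eWP, eW'P, ePW']
    module
  have hv : IsTangent (ofProj P) v := by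
    refine ⟨by simp [hvd, Matrix.conjTranspose_smul, ← smul_neg], ?_⟩
    rw [hJ, J_ofProj_left, hvd]
    simp only [smul_mul_assoc, mul_smul_comm, mul_add, add_mul, mul_neg, neg_mul, ePW, eWP, eW'P,
      ePW']
    simp only [← smul_neg, ← smul_sub, smul_smul, smul_comm Complex.I (2⁻¹ : ℝ), Complex.I_mul_I]
    module
  have hv1 : ip n v v = 1 := by
    have : v * v = -((4⁻¹ : ℝ) • (P + Q)) := by
      rw [hvd]
      simp only [smul_mul_assoc, mul_smul_comm, mul_sub, sub_mul, eWW, eWW', eW'W, eW'W']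
      module
    rw [ip_apply, this]
    simp [hP.trace_one, hQ.trace_one]
    norm_num
  refine ⟨Real.pi • v, hv.smul _, ?_, ?_⟩
  · rw [(ip n).map_smul, LinearMap.smul_apply, (ip n v).map_smul, hv1]
    simp [Real.sqrt_mul_self Real.pi_pos.le]
  · have hK : J v (J (ofProj P) v) = (2⁻¹ : ℝ) • (ofProj P - ofProj Q) := by
      rw [hJ, hvd, J]
      simp only [smul_mul_assoc, mul_smul_comm, mul_sub, sub_mul, mul_add, add_mul, mul_neg,
        neg_mul, eWW, eWW', eW'W, eW'W', ofProj]
      module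
    rw [geod_smul hp hv hv1, hK, Real.cos_pi, Real.sin_pi]
    module

/-- Cauchy–Schwarz for (p, Y) = -([p, q], [q, Y]). It bounds the rate at which the cosine of the
distance to p changes along a curve. -/
theorem ip_tangent_sq_le {p q Y : Mat n} (hp : p ∈ CP n) (hq : q ∈ CP n) (hY : IsTangent q Y) :
    ip n p Y ^ 2 ≤ 4 * overlap p q * (1 - overlap p q) * ip n Y Y := by
  have h1 : ip n p Y = -ip n (J p q) (J q Y) := by
    rw [ip_J_right, hY.J_J, map_neg, neg_neg]
  rw [h1, neg_sq, ← ip_J_J hp hq, ← ip_J_tangent hY]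
  exact ip_mul_self_le (conjTranspose_J (conjTranspose_of_mem_CP hp) (conjTranspose_of_mem_CP hq))
    (hY.J hq).skew

/-- The function y = 2 · overlap - 1 runs from 1 to -1 with |y'| ≤ √(1 - y²) |γ'|; integrating
-(arcsin y)' gives π. -/
theorem le_curveLength {p q : Mat n} (hp : p ∈ CP n) (h : overlap p q = 0) {γ : ℝ → Mat n}
    (hγ : ContDiff ℝ 1 γ) (hM : ∀ t ∈ Set.Icc (0 : ℝ) 1, γ t ∈ CP n) (h0 : γ 0 = p) (h1 : γ 1 = q) :
    Real.pi ≤ curveLength γ := by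
  set y : ℝ → ℝ := fun t => 2 * overlap p (γ t) - 1 with hy
  have hd : ∀ t, HasDerivAt γ (deriv γ t) t := fun t =>
    (hγ.differentiable one_ne_zero t).hasDerivAt
  have hyd : ∀ t, HasDerivAt y (ip n p (deriv γ t)) t := fun t => by
    have := ((((hasDerivAt_ip (hasDerivAt_const t p) (hd t)).div_const 2).add_const
      (1 / ((n : ℝ) + 1))).const_mul 2).sub_const 1
    refine this.congr_deriv ?_
    simp
    ring
  have hγ' : Continuous (deriv γ) := hγ.continuous_deriv le_rfl
  have hint : Continuous fun t => √(ip n (deriv γ t) (deriv γ t)) :=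
    ((contDiff_bilinear (ipL n) (m := 0) contDiff_fst contDiff_snd).continuous.comp
      (hγ'.prodMk hγ')).sqrt
  -- Since arcsin is not differentiable at ±1, where y starts and ends, y is shrunk by κ < 1, and κ
  -- tends to 1 afterwards.
  have key : ∀ κ ∈ Set.Ioo (0 : ℝ) 1, 2 * Real.arcsin κ ≤ curveLength γ := by
    rintro κ ⟨hκ0, hκ1⟩
    have hb : ∀ t ∈ Set.Icc (0 : ℝ) 1, 0 < 1 - (κ * y t) ^ 2 ∧
        κ ^ 2 * (1 - y t ^ 2) ≤ 1 - (κ * y t) ^ 2 ∧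
        1 - y t ^ 2 = 4 * overlap p (γ t) * (1 - overlap p (γ t)) := fun t ht => by
      have e1 := overlap_nonneg hp (hM t ht)
      have e2 := overlap_le_one hp (hM t ht)
      have e3 : 1 - y t ^ 2 = 4 * overlap p (γ t) * (1 - overlap p (γ t)) := by
        simp only [hy]; ring
      have e4 : 0 ≤ 1 - y t ^ 2 := by
        rw [e3]; exact mul_nonneg (by linarith) (by linarith)
      have e5 : κ ^ 2 < 1 := by nlinarith
      have e6 := mul_nonneg (sq_nonneg κ) e4
      exact ⟨by rw [mul_pow]; linarith, by rw [mul_pow]; linarith, e3⟩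
    have hcont : Continuous fun t => -Real.arcsin (κ * y t) :=
      (Real.continuous_arcsin.comp (continuous_const.mul
        (continuous_iff_continuousAt.2 fun t => (hyd t).continuousAt))).neg
    have hderiv : ∀ t ∈ Set.Ioo (0 : ℝ) 1, HasDerivAt (fun t => -Real.arcsin (κ * y t))
        (-(1 / √(1 - (κ * y t) ^ 2) * (κ * ip n p (deriv γ t)))) t := fun t ht => by
      have e := (hb t (Set.Ioo_subset_Icc_self ht)).1
      exact ((Real.hasDerivAt_arcsin (fun h => by rw [h] at e; norm_num at e)
        (fun h => by rw [h] at e; norm_num at e)).comp t ((hyd t).const_mul κ)).neg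
    have := intervalIntegral.sub_le_integral_of_hasDeriv_right_of_le zero_le_one
      hcont.continuousOn (fun t ht => (hderiv t ht).hasDerivWithinAt)
      (hint.integrableOn_Icc (μ := MeasureTheory.volume)) fun t ht => by
        have ht' := Set.Ioo_subset_Icc_self ht
        obtain ⟨e1, e2, e3⟩ := hb t ht'
        have hT : IsTangent (γ t) (deriv γ t) := isTangent_of_hasDerivAt (hd t)
          (Filter.eventually_of_mem (Icc_mem_nhds ht.1 ht.2) hM)
        have e4 := ip_tangent_sq_le hp (hM t ht') hT
        rw [← e3] at e4
        have e5 := ip_self_nonneg hT.skew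
        rw [one_div, inv_mul_eq_div, ← neg_div, div_le_iff₀ (Real.sqrt_pos.2 e1),
          ← Real.sqrt_mul e5]
        refine Real.le_sqrt_of_sq_le ?_
        calc (-(κ * ip n p (deriv γ t))) ^ 2 = κ ^ 2 * ip n p (deriv γ t) ^ 2 := by ring
          _ ≤ κ ^ 2 * ((1 - y t ^ 2) * ip n (deriv γ t) (deriv γ t)) := by gcongr
          _ = ip n (deriv γ t) (deriv γ t) * (κ ^ 2 * (1 - y t ^ 2)) := by ring
          _ ≤ _ := by gcongr
    have hy0 : y 0 = 1 := by simp only [hy, h0, overlap_self hp]; norm_num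
    have hy1 : y 1 = -1 := by simp only [hy, h1, h]; norm_num
    rw [hy0, hy1] at this
    simp only [mul_neg, mul_one, Real.arcsin_neg, neg_neg] at this
    rw [two_mul]
    rw [sub_neg_eq_add] at this
    exact this
  have hlim : Filter.Tendsto (fun κ => 2 * Real.arcsin κ) (𝓝[<] 1) (𝓝 Real.pi) := by
    have : Filter.Tendsto (fun κ => 2 * Real.arcsin κ) (𝓝 1) (𝓝 (2 * Real.arcsin 1)) :=
      (continuous_const.mul Real.continuous_arcsin).tendsto 1
    rw [Real.arcsin_one, mul_div_cancel₀ _ two_ne_zero] at this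
    exact this.mono_left nhdsWithin_le_nhds
  exact le_of_tendsto hlim (Filter.eventually_of_mem (Ioo_mem_nhdsLT zero_lt_one) key)

theorem le_riemDist_of_overlap_eq_zero {p q : Mat n} (hp : p ∈ CP n) (hq : q ∈ CP n)
    (h : overlap p q = 0) : Real.pi ≤ riemDist p q := by
  obtain ⟨v, hv, -, hqv⟩ := exists_geod_of_overlap_eq_zero hp hq h
  refine le_csInf ⟨_, geod p v, (contDiff_Ad_exp _ _).of_le (by simp),
    fun t _ => geod_mem hp hv.skew t, geod_zero _ _, hqv.symm, rfl⟩ ?_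
  rintro L ⟨γ, hγ, hM, h0, h1, rfl⟩
  exact le_curveLength hp h hγ hM h0 h1

theorem riemDist_lt_pi {p q : Mat n} (hp : p ∈ CP n) (hq : q ∈ CP n) (h : 0 < overlap p q) :
    riemDist p q < Real.pi := by
  obtain ⟨v, hv, hπ, rfl⟩ := exists_geod_of_overlap_pos hp hq h
  exact (riemDist_geod_le hp hv).trans_lt hπ

theorem riemDist_le_pi {p q : Mat n} (hp : p ∈ CP n) (hq : q ∈ CP n) :
    riemDist p q ≤ Real.pi := by
  rcases (overlap_nonneg hp hq).eq_or_lt with h | h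
  · obtain ⟨v, hv, hπ, rfl⟩ := exists_geod_of_overlap_eq_zero hp hq h.symm
    exact (riemDist_geod_le hp hv).trans hπ.le
  · exact (riemDist_lt_pi hp hq h).le

theorem exists_overlap_eq_zero (hn : 1 ≤ n) : ∃ a ∈ CP n, ∃ b ∈ CP n, overlap a b = 0 := by
  have h1 : (1 : Mat n)ᴴ * 1 = 1 := by simp
  set σ := Equiv.swap 0 (Fin.last n)
  have h2 : ((1 : Mat n).submatrix id σ)ᴴ * (1 : Mat n).submatrix id σ = 1 := by
    rw [Matrix.conjTranspose_submatrix, Matrix.conjTranspose_one]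
    have := Matrix.submatrix_mul_equiv (1 : Mat n) (1 : Mat n) σ (Equiv.refl _) σ
    rw [one_mul, Matrix.submatrix_one_equiv] at this
    exact this
  refine ⟨_, Ad_baseZ_mem h1, _, Ad_baseZ_mem h2, ?_⟩
  rw [Ad_baseZ_eq h1, Ad_baseZ_eq h2]
  have h3 := trace_mul_proj (isRankOneProj_of_col (conjTranspose_lastCol_mul h1))
    (isRankOneProj_of_col (conjTranspose_lastCol_mul h2))
  have h4 : (lastCol (1 : Mat n))ᴴ * lastCol ((1 : Mat n).submatrix id σ) = 0 := by
    ext i j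
    have : (Fin.last n) ≠ 0 := by
      intro h; have := congrArg Fin.val h; simp at this; omega
    simp [lastCol, Matrix.mul_apply, Matrix.one_apply, σ, this]
  rw [← Matrix.mul_assoc, Matrix.mul_assoc (lastCol 1), h4] at h3
  simp at h3
  exact_mod_cast h3.symm

/-- The assumption n ≥ 1 supplies a pair at distance π. On the single point `CP 0` the diagonal pair
itself is at maximal distance. -/
theorem mem_offAntidiagonal (hn : 1 ≤ n) {p : Mat n × Mat n} :
    p ∈ offAntidiagonal n ↔ p.1 ∈ CP n ∧ p.2 ∈ CP n ∧ 0 < overlap p.1 p.2 := by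
  obtain ⟨a, ha, b, hb, hab⟩ := exists_overlap_eq_zero hn
  constructor
  · rintro ⟨⟨h1, h2⟩, h3⟩
    refine ⟨h1, h2, lt_of_le_of_ne (overlap_nonneg h1 h2) fun h => h3 fun a ha b hb => ?_⟩
    exact (riemDist_le_pi ha hb).trans (le_riemDist_of_overlap_eq_zero h1 h2 h.symm)
  · rintro ⟨h1, h2, h3⟩
    refine ⟨⟨h1, h2⟩, fun h => ?_⟩
    have := (le_riemDist_of_overlap_eq_zero ha hb hab).trans (h a ha b hb)
    exact absurd (riemDist_lt_pi h1 h2 h3) (not_lt.2 this)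

/-! ### Rotations along a geodesic -/

/-- The point `x - k [v, [x, v]] - m [x, v]`; for suitable coefficients it lies on the geodesic
through `x` with direction `J x v`. -/
def turn (k m : ℝ) (x v : Mat n) : Mat n := x - k • J v (J x v) - m • J x v

theorem turn_Ad {g : Mat n} (hg : gᴴ * g = 1) (k m : ℝ) (x v : Mat n) :
    turn k m (Ad g x) (Ad g v) = Ad g (turn k m x v) := by
  simp only [turn, Ad_J hg, Ad_sub, Ad_smul]

theorem J_turn {x v : Mat n} (hx : x ∈ CP n) (hv : IsTangent x v) (k m : ℝ) :
    J (turn k m x v) v = (1 - k * ip n v v) • J x v + m • J v (J x v) := by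
  rw [turn, J_sub_left, J_sub_left, J_smul_left, J_smul_left, J_skew (J v (J x v)) v,
    J_J_J hx hv, J_skew (J x v) v]
  module

/-- The addition formulas for cosine and sine in the coefficients k and m; the same v serves at
every point of the geodesic. -/
theorem turn_turn {x v : Mat n} (hx : x ∈ CP n) (hv : IsTangent x v) (k m k' m' : ℝ) :
    turn k' m' (turn k m x v) v =
      turn (k + k' * (1 - k * ip n v v) + m' * m)
        (m - k' * m * ip n v v + m' * (1 - k * ip n v v)) x v := by
  rw [turn, J_turn hx hv, J_add_right, J_smul_right, J_smul_right, J_J_J hx hv, turn, turn]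
  module

/-- The coefficient is the sine of the angle between the two points, divided by |v|. -/
theorem J_turn_turn {x v : Mat n} (hx : x ∈ CP n) (hv : IsTangent x v) (k m k' m' : ℝ) :
    J (turn k m x v) (turn k' m' x v) =
      (m' - m - ip n v v * (k * m' - m * k')) • v := by
  simp only [turn, J_sub_left, J_sub_right, J_smul_left, J_smul_right, J_self,
    J_base_normal hv, hv.J_J, J_J_normal hx hv]
  rw [J_skew (J v (J x v)) x, J_base_normal hv, J_skew (J v (J x v)) (J x v), J_J_normal hx hv,
    J_skew (J x v) x, hv.J_J]
  module

theorem ip_turn_turn {x v : Mat n} (hx : x ∈ CP n) (hv : IsTangent x v) (k m k' m' : ℝ) :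
    ip n (turn k m x v) (turn k' m' x v) = ip n x x -
      ip n v v * (k + k' - k * k' * ip n v v - m * m') := by
  have h1 : ip n x (J x v) = 0 := ip_tangent_base (hv.J hx)
  have h2 := ip_J_J_normal x v
  simp only [turn, map_sub, map_smul, LinearMap.sub_apply, LinearMap.smul_apply, smul_eq_mul,
    h1, ip_comm (J x v) x, ip_comm (J v (J x v)) x, ip_comm (J v (J x v)) (J x v), h2,
    ip_base_normal hv, ip_normal_normal hx hv, ip_J_tangent hv]
  ring

theorem turn_eq_geod {x v : Mat n} (hx : x ∈ CP n) (hv : IsTangent x v) {k m c : ℝ}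
    (hc : Real.cos (c * √(ip n v v)) = 1 - k * ip n v v)
    (hs : Real.sin (c * √(ip n v v)) = m * √(ip n v v)) : turn k m x v = geod x v (-c) := by
  rw [geod_eq hx hv, neg_mul, Real.cos_neg, Real.sin_neg, hc, hs]
  by_cases h0 : √(ip n v v) = 0
  · rw [eq_zero_of_sqrt_ip_eq_zero hv.skew h0]
    simp [turn, J_zero_right]
  have h1 : ip n v v ≠ 0 := fun h => h0 (by rw [h, Real.sqrt_zero])
  rw [sub_sub_cancel, mul_div_cancel_right₀ _ h1, neg_div, mul_div_cancel_right₀ _ h0, turn]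
  module

theorem exists_cos_sin_eq {a b : ℝ} (h : a ^ 2 + b ^ 2 = 1) :
    ∃ θ, Real.cos θ = a ∧ Real.sin θ = b := by
  have h1 : -1 ≤ a := by nlinarith [sq_nonneg b]
  have h2 : a ≤ 1 := by nlinarith [sq_nonneg b]
  have h3 : √(1 - a ^ 2) = |b| := by rw [← Real.sqrt_sq_eq_abs]; congr 1; linarith
  rcases le_total 0 b with hb | hb
  · exact ⟨Real.arccos a, Real.cos_arccos h1 h2, by rw [Real.sin_arccos, h3, abs_of_nonneg hb]⟩
  · exact ⟨-Real.arccos a, by rw [Real.cos_neg, Real.cos_arccos h1 h2],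
      by rw [Real.sin_neg, Real.sin_arccos, h3, abs_of_nonpos hb, neg_neg]⟩

theorem exists_angle {k m r : ℝ} (h : m ^ 2 + k ^ 2 * r ^ 2 = 2 * k) :
    ∃ c, Real.cos (c * r) = 1 - k * r ^ 2 ∧ Real.sin (c * r) = m * r := by
  by_cases h0 : r = 0
  -- For r = 0 every c works, so 0 is a default.
  · exact ⟨0, by simp [h0]⟩
  obtain ⟨θ, h1, h2⟩ := exists_cos_sin_eq (a := 1 - k * r ^ 2) (b := m * r)
    (by linear_combination r ^ 2 * h)
  exact ⟨θ / r, by rwa [div_mul_cancel₀ _ h0], by rwa [div_mul_cancel₀ _ h0]⟩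

/-- exp(-tv) commutes with v, so moving x along the geodesic fixes v. -/
theorem isTangent_geod {x v : Mat n} (hv : IsTangent x v) (t : ℝ) : IsTangent (geod x v t) v := by
  have h : Ad (NormedSpace.exp (t • -v)) v = v := by
    have hd : ∀ t, HasDerivAt (fun t : ℝ => Ad (NormedSpace.exp (t • -v)) v) 0 t := fun t => by
      refine (hasDerivAt_Ad_exp (a := -v) (by rw [Matrix.conjTranspose_neg, hv.skew])
        (hasDerivAt_const t v)).congr_deriv ?_
      rw [J_neg_left, J_self]
      simp [Ad]
    have := is_const_of_deriv_eq_zero (fun t => (hd t).differentiableAt) (fun t => (hd t).deriv) t 0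
    rw [this, Ad_zero_exp]
  have := hv.Ad (conjTranspose_exp_mul_exp (conjTranspose_smul_neg hv.skew t))
  rwa [h] at this

theorem turn_mem {x v : Mat n} (hx : x ∈ CP n) (hv : IsTangent x v) {k m : ℝ}
    (h : m ^ 2 + k ^ 2 * ip n v v = 2 * k) :
    turn k m x v ∈ CP n ∧ IsTangent (turn k m x v) v := by
  have hr := Real.sq_sqrt (ip_self_nonneg hv.skew)
  rw [← hr] at h
  obtain ⟨c, h1, h2⟩ := exists_angle h
  rw [hr] at h1
  rw [turn_eq_geod hx hv h1 h2]
  exact ⟨geod_mem hx hv.skew _, isTangent_geod hv _⟩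

/-! ### The coefficients -/

/-- The coefficient `(1 - cos α) / r²`, where `ρ² = 1 - r²`. -/
def kCoeff (R R' ρ : ℝ) : ℝ := 2 * R' / (R + R' + ρ)

/-- The coefficient `sin α / r`, where `ρ² = 1 - r²`. -/
def mCoeff (R R' ρ : ℝ) : ℝ := (1 + 2 * R' * ρ) / (R + R' + ρ)

section Coefficients

variable {R R' ρ : ℝ}

/-- This is cos² + sin² = 1 for 1 - k r² and m r, after division by r². -/
theorem coeff_circle (hR : 0 < R) (hR' : 0 < R') (hRR : 4 * R * R' = 1) (hρ : 0 ≤ ρ) :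
    mCoeff R R' ρ ^ 2 + kCoeff R R' ρ ^ 2 * (1 - ρ ^ 2) = 2 * kCoeff R R' ρ := by
  have : R + R' + ρ ≠ 0 := by positivity
  rw [mCoeff, kCoeff]
  field_simp
  linear_combination -hRR

/-- With `coeff_balance_m`, this matches the normal and the tangential part of the two moment maps.
-/
theorem coeff_balance_k : R * kCoeff R R' ρ = R' * kCoeff R' R ρ := by
  rw [kCoeff, kCoeff, add_comm R']; ring

theorem coeff_balance_m (hR : 0 < R) (hR' : 0 < R') (hRR : 4 * R * R' = 1) (hρ : 0 ≤ ρ) :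
    R * mCoeff R R' ρ + R' * mCoeff R' R ρ = 1 := by
  have : R + R' + ρ ≠ 0 := by positivity
  rw [mCoeff, mCoeff, add_comm R']
  field_simp
  linear_combination ρ * hRR

/-- The addition formula: sin(α₁ + α₂) = 2rρ, divided by r. Likewise `coeff_cos` is 1 - cos(α₁ + α₂)
= 2r², divided by r². -/
theorem coeff_sin (hR : 0 < R) (hR' : 0 < R') (hRR : 4 * R * R' = 1) (hρ : 0 ≤ ρ) :
    mCoeff R' R ρ + mCoeff R R' ρ - (1 - ρ ^ 2) *
      (kCoeff R R' ρ * mCoeff R' R ρ + kCoeff R' R ρ * mCoeff R R' ρ) = 2 * ρ := by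
  have : R + R' + ρ ≠ 0 := by positivity
  simp only [mCoeff, kCoeff, add_comm R' R]
  field_simp
  linear_combination (-2 * (1 - ρ ^ 2) * ρ) * hRR

theorem coeff_cos (hR : 0 < R) (hR' : 0 < R') (hRR : 4 * R * R' = 1) (hρ : 0 ≤ ρ) :
    kCoeff R R' ρ + kCoeff R' R ρ - kCoeff R R' ρ * kCoeff R' R ρ * (1 - ρ ^ 2) +
      mCoeff R R' ρ * mCoeff R' R ρ = 2 := by
  have : R + R' + ρ ≠ 0 := by positivity
  simp only [mCoeff, kCoeff, add_comm R' R]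
  field_simp
  linear_combination (-1 + 2 * ρ ^ 2) * hRR

end Coefficients

/-! ### The map and its inverse -/

/-- The map from the disc bundle to `CP n × CP n`. -/
def toPair (R R' : ℝ) (p : Mat n × Mat n) : Mat n × Mat n :=
  (turn (kCoeff R R' √(1 - ip n p.2 p.2)) (mCoeff R R' √(1 - ip n p.2 p.2)) p.1 p.2,
    turn (kCoeff R' R √(1 - ip n p.2 p.2)) (-mCoeff R' R √(1 - ip n p.2 p.2)) p.1 p.2)

/-- The inverse of `toPair`. -/
def fromPair (R R' : ℝ) (p : Mat n × Mat n) : Mat n × Mat n :=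
  (turn (kCoeff R R' √(overlap p.1 p.2)) (-mCoeff R R' √(overlap p.1 p.2)) p.1
      (-(2 * √(overlap p.1 p.2))⁻¹ • J p.1 p.2),
    -(2 * √(overlap p.1 p.2))⁻¹ • J p.1 p.2)

section Maps

variable {R R' : ℝ}

theorem toPair_diagAct {g : Mat n} (hg : gᴴ * g = 1) (p : Mat n × Mat n) :
    toPair R R' (diagAct g p) = diagAct g (toPair R R' p) := by
  simp only [toPair, diagAct, ip_Ad hg, turn_Ad hg]

theorem ip_eq_one_sub_sq {v : Mat n} (h : ip n v v < 1) :
    ip n v v = 1 - √(1 - ip n v v) ^ 2 := by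
  rw [Real.sq_sqrt (by linarith)]; ring

theorem overlap_toPair (hR : 0 < R) (hR' : 0 < R') (hRR : 4 * R * R' = 1) {p : Mat n × Mat n}
    (hp : p ∈ discBundle n 1) :
    overlap (toPair R R' p).1 (toPair R R' p).2 = 1 - ip n p.2 p.2 := by
  obtain ⟨hx, hv, h1⟩ := mem_discBundle.1 hp
  have hc := coeff_cos hR hR' hRR (Real.sqrt_nonneg (1 - ip n p.2 p.2))
  rw [← ip_eq_one_sub_sq h1] at hc
  have hx1 := overlap_self hx
  rw [overlap] at hx1 ⊢
  simp only [toPair, ip_turn_turn hx hv]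
  linear_combination hx1 - ip n p.2 p.2 / 2 * hc

theorem J_toPair (hR : 0 < R) (hR' : 0 < R') (hRR : 4 * R * R' = 1) {p : Mat n × Mat n}
    (hp : p ∈ discBundle n 1) :
    J (toPair R R' p).1 (toPair R R' p).2 = (-(2 * √(1 - ip n p.2 p.2))) • p.2 := by
  obtain ⟨hx, hv, h1⟩ := mem_discBundle.1 hp
  have hc := coeff_sin hR hR' hRR (Real.sqrt_nonneg (1 - ip n p.2 p.2))
  rw [← ip_eq_one_sub_sq h1] at hc
  rw [toPair, J_turn_turn hx hv, ← hc]
  congr 1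
  ring

theorem fromPair_toPair (hR : 0 < R) (hR' : 0 < R') (hRR : 4 * R * R' = 1) {p : Mat n × Mat n}
    (hp : p ∈ discBundle n 1) : fromPair R R' (toPair R R' p) = p := by
  obtain ⟨hx, hv, h1⟩ := mem_discBundle.1 hp
  have hc := coeff_circle hR hR' hRR (Real.sqrt_nonneg (1 - ip n p.2 p.2))
  rw [← ip_eq_one_sub_sq h1] at hc
  have hρ : 0 < √(1 - ip n p.2 p.2) := Real.sqrt_pos.2 (by linarith)
  rw [fromPair, overlap_toPair hR hR' hRR hp, J_toPair hR hR' hRR hp, smul_smul, neg_mul_neg,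
    inv_mul_cancel₀ (by positivity), one_smul]
  refine Prod.ext ?_ rfl
  simp only [toPair]
  rw [turn_turn hx hv]
  simp only [turn]
  rw [show ∀ k m c : ℝ, m - k * m * c + -m * (1 - k * c) = 0 by intros; ring]
  rw [show ∀ k m c : ℝ, k + k * (1 - k * c) + -m * m = 2 * k - (m ^ 2 + k ^ 2 * c) by
    intros; ring, hc, sub_self]
  simp

theorem toPair_mem (hn : 1 ≤ n) (hR : 0 < R) (hR' : 0 < R') (hRR : 4 * R * R' = 1)
    {p : Mat n × Mat n} (hp : p ∈ discBundle n 1) : toPair R R' p ∈ offAntidiagonal n := by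
  obtain ⟨hx, hv, h1⟩ := mem_discBundle.1 hp
  have hρ := Real.sqrt_nonneg (1 - ip n p.2 p.2)
  have hc := coeff_circle hR hR' hRR hρ
  have hc' := coeff_circle hR' hR (by linarith) hρ
  rw [← ip_eq_one_sub_sq h1] at hc hc'
  refine (mem_offAntidiagonal hn).2 ⟨(turn_mem hx hv hc).1, (turn_mem hx hv ?_).1, ?_⟩
  · rwa [neg_sq]
  · rw [overlap_toPair hR hR' hRR hp]; linarith

theorem fromPair_mem (hn : 1 ≤ n) (hR : 0 < R) (hR' : 0 < R') (hRR : 4 * R * R' = 1)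
    {p : Mat n × Mat n} (hp : p ∈ offAntidiagonal n) :
    fromPair R R' p ∈ discBundle n 1 ∧ toPair R R' (fromPair R R' p) = p := by
  obtain ⟨hp1, hp2, h0⟩ := (mem_offAntidiagonal hn).1 hp
  have hw := isTangent_J hp1 (conjTranspose_of_mem_CP hp2)
  have hww := ip_J_J hp1 hp2
  have hq := overlap_smul_eq hp1 hp2
  have hρ : 0 < √(overlap p.1 p.2) := Real.sqrt_pos.2 h0
  have hρ2 : overlap p.1 p.2 = √(overlap p.1 p.2) ^ 2 := (Real.sq_sqrt h0.le).symm
  rw [fromPair]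
  set ρ := √(overlap p.1 p.2)
  have hv := hw.smul (-(2 * ρ)⁻¹)
  have hvv : ip n (-(2 * ρ)⁻¹ • J p.1 p.2) (-(2 * ρ)⁻¹ • J p.1 p.2) = 1 - ρ ^ 2 := by
    rw [(ip n).map_smul, LinearMap.smul_apply, map_smul, hww, hρ2]
    simp only [smul_eq_mul]
    field_simp
    ring
  -- The pair (2, 2ρ) consists of (1 - cos α)/r² and (sin α)/r for the total angle α = α₁ + α₂; the
  -- minus sign puts q ahead of p.
  have hq' : p.2 = turn 2 (-(2 * ρ)) p.1 (-(2 * ρ)⁻¹ • J p.1 p.2) := by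
    refine smul_right_injective (Mat n) (r := 2 * overlap p.1 p.2) (by positivity) ?_
    simp only [turn, J_smul_right, J_smul_left]
    rw [hq, hρ2]
    match_scalars
    · ring
    · field_simp
    · field_simp
  set v := -(2 * ρ)⁻¹ • J p.1 p.2
  have hc := coeff_circle hR hR' hRR hρ.le
  rw [← hvv, ← neg_sq (mCoeff _ _ _)] at hc
  have hm := turn_mem hp1 hv hc
  have h1 : √(1 - ip n v v) = ρ := by rw [hvv, sub_sub_cancel, Real.sqrt_sq hρ.le]
  refine ⟨mem_discBundle.2 ⟨hm.1, hm.2, by rw [hvv]; nlinarith⟩, ?_⟩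
  simp only [toPair, h1, turn_turn hp1 hv]
  refine Prod.ext ?_ ?_
  · simp only [turn]
    rw [show ∀ k m c : ℝ, -m - k * -m * c + m * (1 - k * c) = 0 by intros; ring]
    rw [show ∀ k m c : ℝ, k + k * (1 - k * c) + m * -m = 2 * k - ((-m) ^ 2 + k ^ 2 * c) by
      intros; ring, hc, sub_self]
    simp
  · simp only
    conv_rhs => rw [hq']
    have e1 := coeff_sin hR hR' hRR hρ.le
    have e2 := coeff_cos hR hR' hRR hρ.le
    rw [← hvv] at e1 e2
    congr 1
    · linear_combination e2
    · linear_combination -e1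

theorem toPair_bijOn (hn : 1 ≤ n) (hR : 0 < R) (hR' : 0 < R') (hRR : 4 * R * R' = 1) :
    Set.BijOn (toPair R R') (discBundle n 1) (offAntidiagonal n) :=
  ⟨fun _ hp => toPair_mem hn hR hR' hRR hp,
    Set.LeftInvOn.injOn (f₁' := fromPair R R') fun _ hp => fromPair_toPair hR hR' hRR hp,
    fun p hp => ⟨fromPair R R' p, fromPair_mem hn hR hR' hRR hp⟩⟩

end Maps

/-! ### Smoothness of the map and of its inverse -/

theorem isSmoothOn_of_contDiffOn {E E' : Type*} [NormedAddCommGroup E] [NormedSpace ℝ E]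
    [NormedAddCommGroup E'] [NormedSpace ℝ E'] {f : E → E'} {M U : Set E} (hU : IsOpen U)
    (hMU : M ⊆ U) (hf : ContDiffOn ℝ ∞ f U) : IsSmoothOn f M :=
  fun _ hp => ⟨U, hU, hMU hp, f, hf, fun _ _ => rfl⟩

theorem contDiffOn_turn {E : Type*} [NormedAddCommGroup E] [NormedSpace ℝ E] {U : Set E}
    {k m : E → ℝ} {f g : E → Mat n} (hk : ContDiffOn ℝ ∞ k U) (hm : ContDiffOn ℝ ∞ m U)
    (hf : ContDiffOn ℝ ∞ f U) (hg : ContDiffOn ℝ ∞ g U) :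
    ContDiffOn ℝ ∞ (fun e => turn (k e) (m e) (f e) (g e)) U := by
  have h1 : ContDiffOn ℝ ∞ (fun e => J (f e) (g e)) U := (hf.mul hg).sub (hg.mul hf)
  have h2 : ContDiffOn ℝ ∞ (fun e => J (g e) (J (f e) (g e))) U := (hg.mul h1).sub (h1.mul hg)
  exact (hf.sub (hk.smul h2)).sub (hm.smul h1)

section Smooth

variable {R R' : ℝ} {E : Type*} [NormedAddCommGroup E] [NormedSpace ℝ E] {U : Set E} {ρ : E → ℝ}

theorem contDiffOn_kCoeff (hR : 0 < R) (hR' : 0 < R') (hρ : ContDiffOn ℝ ∞ ρ U)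
    (h0 : ∀ e ∈ U, 0 ≤ ρ e) : ContDiffOn ℝ ∞ (fun e => kCoeff R R' (ρ e)) U :=
  contDiffOn_const.div (contDiffOn_const.add hρ) fun e he => by have := h0 e he; positivity

theorem contDiffOn_mCoeff (hR : 0 < R) (hR' : 0 < R') (hρ : ContDiffOn ℝ ∞ ρ U)
    (h0 : ∀ e ∈ U, 0 ≤ ρ e) : ContDiffOn ℝ ∞ (fun e => mCoeff R R' (ρ e)) U :=
  (contDiffOn_const.add (contDiffOn_const.mul hρ)).div (contDiffOn_const.add hρ)
    fun e he => by have := h0 e he; positivity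

end Smooth

theorem contDiff_ip_snd : ContDiff ℝ ∞ fun p : Mat n × Mat n => ip n p.2 p.2 :=
  contDiff_ip contDiff_snd contDiff_snd

theorem contDiff_overlap : ContDiff ℝ ∞ fun p : Mat n × Mat n => overlap p.1 p.2 :=
  ((contDiff_ip contDiff_fst contDiff_snd).div_const 2).add contDiff_const

theorem isOpen_unitFiber : IsOpen {p : Mat n × Mat n | ip n p.2 p.2 < 1} :=
  isOpen_lt contDiff_ip_snd.continuous continuous_const

theorem isOpen_overlap_pos : IsOpen {p : Mat n × Mat n | 0 < overlap p.1 p.2} :=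
  isOpen_lt continuous_const contDiff_overlap.continuous

section Maps

variable {R R' : ℝ}

theorem contDiffOn_toPair (hR : 0 < R) (hR' : 0 < R') :
    ContDiffOn ℝ ∞ (toPair R R') {p : Mat n × Mat n | ip n p.2 p.2 < 1} := by
  have hρ : ContDiffOn ℝ ∞ (fun p : Mat n × Mat n => √(1 - ip n p.2 p.2))
      {p : Mat n × Mat n | ip n p.2 p.2 < 1} :=
    (contDiff_const.sub contDiff_ip_snd).contDiffOn.sqrt fun p hp => (sub_pos.2 hp).ne'
  have h0 : ∀ p ∈ {p : Mat n × Mat n | ip n p.2 p.2 < 1}, 0 ≤ √(1 - ip n p.2 p.2) :=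
    fun _ _ => Real.sqrt_nonneg _
  exact (contDiffOn_turn (contDiffOn_kCoeff hR hR' hρ h0) (contDiffOn_mCoeff hR hR' hρ h0)
    contDiffOn_fst contDiffOn_snd).prodMk
      (contDiffOn_turn (contDiffOn_kCoeff hR' hR hρ h0) (contDiffOn_mCoeff hR' hR hρ h0).neg
        contDiffOn_fst contDiffOn_snd)

theorem contDiffOn_fromPair (hR : 0 < R) (hR' : 0 < R') :
    ContDiffOn ℝ ∞ (fromPair R R') {p : Mat n × Mat n | 0 < overlap p.1 p.2} := by
  have hρ : ContDiffOn ℝ ∞ (fun p : Mat n × Mat n => √(overlap p.1 p.2))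
      {p : Mat n × Mat n | 0 < overlap p.1 p.2} :=
    contDiff_overlap.contDiffOn.sqrt fun p hp => ne_of_gt hp
  have h0 : ∀ p ∈ {p : Mat n × Mat n | 0 < overlap p.1 p.2}, 0 ≤ √(overlap p.1 p.2) :=
    fun _ _ => Real.sqrt_nonneg _
  have hv : ContDiffOn ℝ ∞ (fun p : Mat n × Mat n => -(2 * √(overlap p.1 p.2))⁻¹ • J p.1 p.2)
      {p : Mat n × Mat n | 0 < overlap p.1 p.2} :=
    ((contDiffOn_const.mul hρ).inv fun p hp =>
      mul_ne_zero two_ne_zero (Real.sqrt_pos.2 hp).ne').neg.smul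
        (contDiff_J contDiff_fst contDiff_snd).contDiffOn
  exact (contDiffOn_turn (contDiffOn_kCoeff hR hR' hρ h0) (contDiffOn_mCoeff hR hR' hρ h0).neg
    contDiffOn_fst hv).prodMk hv

end Maps

/-! ### Moment maps -/

/-- The moment map of the disc bundle. -/
def discMoment (s : ℝ) (p : Mat n × Mat n) : Mat n := -J p.1 p.2 - s • p.1

/-- The moment map of `CP n × CP n`. -/
def pairMoment (R R' : ℝ) (p : Mat n × Mat n) : Mat n := R • p.1 - R' • p.2

theorem hasDerivAt_fst {γ : ℝ → Mat n × Mat n} {ξ : Mat n × Mat n} {t : ℝ}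
    (h : HasDerivAt γ ξ t) : HasDerivAt (fun u => (γ u).1) ξ.1 t := h.fst

theorem hasDerivAt_snd {γ : ℝ → Mat n × Mat n} {ξ : Mat n × Mat n} {t : ℝ}
    (h : HasDerivAt γ ξ t) : HasDerivAt (fun u => (γ u).2) ξ.2 t := h.snd

/-- The inclusion of the orbit into su(n+1) is the moment map of the Fubini–Study form. -/
theorem fubiniStudy_J {x a X : Mat n} (hX : IsTangent x X) :
    fubiniStudy n x (J a x) X = ip n X a := by
  rw [fubiniStudy, ip_J_left, ip_J_right, hX.J_J, map_neg, neg_neg, ip_comm]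

theorem isMomentMap_pairMoment (R R' : ℝ) :
    IsMomentMap (offAntidiagonal n) (productForm n R R') (pairMoment R R') where
  smooth := isSmoothOn_of_contDiffOn isOpen_univ (Set.subset_univ _)
    ((contDiff_fst.const_smul R).sub (contDiff_snd.const_smul R')).contDiffOn
  mem_su p hp := ⟨by
      simp [pairMoment, conjTranspose_of_mem_CP hp.1.1, conjTranspose_of_mem_CP hp.1.2]
      abel, by
      simp [pairMoment, trace_of_mem_CP hp.1.1, trace_of_mem_CP hp.1.2]⟩
  equivariant g _ p _ := by simp [pairMoment, diagAct, Ad_sub, Ad_smul]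
  hamiltonian a ha p hp γ hγ := by
    suffices key : ∀ ξ, HasDerivAt γ ξ 0 → productForm n R R' p (fundamentalField a p) ξ =
        deriv (fun t => ip n (pairMoment R R' (γ t)) a) 0 from key _ hγ.hasDerivAt
    intro ξ hd
    have h0 := hγ.1
    have h1 := hasDerivAt_fst hd
    have h2 := hasDerivAt_snd hd
    have t1 := isTangent_of_hasDerivAt h1 (hγ.eventually_mem.mono fun t ht => ht.1.1)
    have t2 := isTangent_of_hasDerivAt h2 (hγ.eventually_mem.mono fun t ht => ht.1.2)
    rw [h0] at t1 t2
    have h := hasDerivAt_ip ((h1.const_smul R).sub (h2.const_smul R')) (hasDerivAt_const 0 a)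
    refine Eq.trans ?_ h.deriv.symm
    rw [fundamentalField_eq ha.1, productForm]
    dsimp only
    rw [fubiniStudy_J t1, fubiniStudy_J t2]
    simp

/-- The dλ part contributes -λ(a^#) = -(v, [a, x]) = -([x, v], a), and the magnetic term contributes
-s x. -/
theorem isMomentMap_discMoment (s : ℝ) :
    IsMomentMap (discBundle n 1) (magneticForm n s) (discMoment s) where
  smooth := isSmoothOn_of_contDiffOn isOpen_univ (Set.subset_univ _)
    ((contDiff_J contDiff_fst contDiff_snd).neg.sub (contDiff_fst.const_smul s)).contDiffOn
  mem_su p hp := by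
    obtain ⟨hx, hv, -⟩ := mem_discBundle.1 hp
    refine ⟨?_, ?_⟩
    · simp [discMoment, conjTranspose_of_mem_CP hx, (hv.J hx).skew]
      abel
    · simp [discMoment, trace_of_mem_CP hx, trace_J]
  equivariant g hg p _ := by
    simp [discMoment, diagAct, Ad_sub, Ad_smul, Ad_neg,
      Ad_J (conjTranspose_mul_self_of_mem_SU hg)]
  hamiltonian a ha p hp γ hγ := by
    suffices key : ∀ ξ, HasDerivAt γ ξ 0 → magneticForm n s p (fundamentalField a p) ξ =
        deriv (fun t => ip n (discMoment s (γ t)) a) 0 from key _ hγ.hasDerivAt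
    intro ξ hd
    have h0 := hγ.1
    have h1 := hasDerivAt_fst hd
    have h2 := hasDerivAt_snd hd
    have t1 := isTangent_of_hasDerivAt h1
      (hγ.eventually_mem.mono fun t ht => (mem_discBundle.1 ht).1)
    rw [h0] at t1
    have h := hasDerivAt_ip ((hasDerivAt_J h1 h2).neg.sub (h1.const_smul s)) (hasDerivAt_const 0 a)
    refine Eq.trans ?_ h.deriv.symm
    rw [fundamentalField_eq ha.1, magneticForm_eq]
    dsimp only
    rw [fubiniStudy_J t1, h0]
    have e1 : ip n (J a p.2) ξ.1 = -ip n (J ξ.1 p.2) a := by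
      rw [ip_J_right, J_skew, map_neg, ip_comm]
    have e2 : ip n ξ.2 (J a p.1) = ip n (J p.1 ξ.2) a := by
      rw [ip_comm, ip_J_right, ip_comm]
    simp [e1, e2]
    ring

theorem pairMoment_toPair {R R' : ℝ} (hR : 0 < R) (hR' : 0 < R') (hRR : 4 * R * R' = 1)
    (p : Mat n × Mat n) : pairMoment R R' (toPair R R' p) = discMoment (R' - R) p := by
  have h1 := coeff_balance_k (R := R) (R' := R') (ρ := √(1 - ip n p.2 p.2))
  have h2 := coeff_balance_m hR hR' hRR (Real.sqrt_nonneg (1 - ip n p.2 p.2))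
  simp only [pairMoment, toPair, turn, discMoment]
  match_scalars
  · ring
  · linear_combination -h1
  · linear_combination -h2

/-! ### Tangent vectors of the disc bundle -/

/-- The symmetric space relation [𝔭, 𝔭] ⊆ 𝔨. On U = [x, [v, w]], ad_x² acts as -4 by Jacobi, but as
-1 because U is tangent, so U = 0. -/
theorem J_base_J {x v w : Mat n} (hx : x ∈ CP n) (hv : IsTangent x v) (hw : IsTangent x w) :
    J x (J v w) = 0 := by
  have h3 := (isTangent_J hx (conjTranspose_J hv.skew hw.skew)).J_J
  have h1 : J x (J x (J x (J v w))) = (-4 : ℝ) • J x (J v w) := by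
    simp only [J_jacobi x v w, J_add_right, J_jacobi x (J x v) w, J_jacobi x v (J x w),
      J_jacobi x (J x v) (J x w), hv.J_J, hw.J_J, J_neg_left, J_neg_right]
    module
  rw [h1] at h3
  have h4 : (3 : ℝ) • J x (J v w) = 0 := by
    have h5 : ∀ U : Mat n, (3 : ℝ) • U = -((-4 : ℝ) • U) - U := fun U => by module
    rw [h5, h3]
    abel
  exact (smul_eq_zero.1 h4).resolve_left (by norm_num)

/-- The linearization of the equations vᴴ = -v and [x, [x, v]] = -v along a curve. -/
theorem velocity_discBundle {p : Mat n × Mat n} {γ : ℝ → Mat n × Mat n}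
    {ξ : Mat n × Mat n} (hγ : IsCurveThrough (discBundle n 1) p γ) (hd : HasDerivAt γ ξ 0) :
    IsTangent p.1 ξ.1 ∧ (ξ.2)ᴴ = -ξ.2 ∧
      J ξ.1 (J p.1 p.2) + J p.1 (J ξ.1 p.2 + J p.1 ξ.2) =
        -ξ.2 := by
  have h0 := hγ.1
  have hM := hγ.eventually_mem.mono fun t ht => mem_discBundle.1 ht
  have h1 := hasDerivAt_fst hd
  have h2 := hasDerivAt_snd hd
  have t1 := isTangent_of_hasDerivAt h1 (hM.mono fun t ht => ht.1)
  have h3 : HasDerivAt (fun u => ((γ u).2)ᴴ) (ξ.2)ᴴ 0 := h2.star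
  have h4 : HasDerivAt (fun u => -(γ u).2) (ξ.2)ᴴ 0 :=
    h3.congr_of_eventuallyEq (hM.mono fun u hu => hu.2.1.skew.symm)
  have h5 := hasDerivAt_J h1 (hasDerivAt_J h1 h2)
  have h6 := h5.congr_of_eventuallyEq (f₁ := fun u => -(γ u).2)
    (hM.mono fun u hu => hu.2.1.J_J.symm)
  rw [h0] at t1 h6
  exact ⟨t1, h4.unique h2.neg, h6.unique h2.neg⟩

theorem isCurveThrough_orbit {p : Mat n × Mat n} (hp : p ∈ discBundle n 1) {a : Mat n}
    (ha : aᴴ = -a) : IsCurveThrough (discBundle n 1) p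
      fun t : ℝ => diagAct (NormedSpace.exp (t • a)) p := by
  obtain ⟨hx, hv, h1⟩ := mem_discBundle.1 hp
  refine isCurveThrough_of_eventually (Prod.ext (Ad_zero_exp _ _) (Ad_zero_exp _ _))
    ((contDiff_Ad_exp _ _).prodMk (contDiff_Ad_exp _ _)) (Filter.Eventually.of_forall fun t => ?_)
  have hg := conjTranspose_exp_mul_exp (a := t • a) (by simp [ha])
  refine mem_discBundle.2 ⟨Ad_mem_CP hg hx, hv.Ad hg, ?_⟩
  rw [diagAct, ip_Ad hg]
  exact h1

theorem hasDerivAt_vertical (x v Y : Mat n) :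
    HasDerivAt (fun t : ℝ => (x, v + t • Y)) (0, Y) 0 := by
  have h : HasDerivAt (fun t : ℝ => v + t • Y) Y 0 := by
    have := ((hasDerivAt_id (0 : ℝ)).smul_const Y).const_add v
    rw [one_smul] at this
    exact this
  exact (hasDerivAt_const (0 : ℝ) x).prodMk h

theorem isCurveThrough_vertical {p : Mat n × Mat n} (hp : p ∈ discBundle n 1) {Y : Mat n}
    (hY : IsTangent p.1 Y) :
    IsCurveThrough (discBundle n 1) p fun t : ℝ => (p.1, p.2 + t • Y) := by
  obtain ⟨hx, hv, h1⟩ := mem_discBundle.1 hp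
  have hs : ContDiff ℝ ∞ fun t : ℝ => (p.1, p.2 + t • Y) :=
    contDiff_const.prodMk (contDiff_const.add (contDiff_id.smul contDiff_const))
  refine isCurveThrough_of_eventually (by simp) hs ?_
  have ho := isOpen_unitFiber.preimage hs.continuous
  filter_upwards [ho.mem_nhds (by simpa using h1)] with t ht
  refine mem_discBundle.2 ⟨hx, ⟨?_, ?_⟩, ht⟩
  · simp [hv.skew, hY.skew]; abel
  · simp only [J_add_right, J_smul_right, hv.J_J, hY.J_J]; module

/-- A tangent vector of the disc bundle is a fundamental vector plus a vertical vector. -/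
theorem exists_fundamental_add_vertical {p : Mat n × Mat n} (hp : p ∈ discBundle n 1)
    {γ : ℝ → Mat n × Mat n} {ξ : Mat n × Mat n} (hγ : IsCurveThrough (discBundle n 1) p γ)
    (hd : HasDerivAt γ ξ 0) :
    ∃ a ∈ su n, ∃ Y, IsTangent p.1 Y ∧ ξ = fundamentalField a p + (0, Y) := by
  obtain ⟨hx, hv, h1⟩ := mem_discBundle.1 hp
  obtain ⟨hX, hs, he⟩ := velocity_discBundle hγ hd
  have ha : (J p.1 ξ.1)ᴴ = -J p.1 ξ.1 := (hX.J hx).skew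
  have hx' : J (J p.1 ξ.1) p.1 = ξ.1 := by rw [J_skew, hX.J_J, neg_neg]
  obtain ⟨-, hs', he'⟩ := velocity_discBundle (isCurveThrough_orbit hp ha) 
    (hasDerivAt_diagAct_exp ha p)
  dsimp only at hs' he'
  rw [hx'] at he'
  -- The field of a = [x, X] has base component X. Subtracting it leaves base component zero, and
  -- the linearized equations then say that the remainder is tangent at x.
  refine ⟨J p.1 ξ.1, ⟨ha, trace_J _ _⟩, ξ.2 - J (J p.1 ξ.1) p.2, ⟨?_, ?_⟩, ?_⟩
  · rw [Matrix.conjTranspose_sub, hs, hs']; abel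
  · have := congrArg₂ (fun a b => a - b) he he'
    rw [J_sub_right, J_sub_right, neg_sub', ← this]
    simp only [J_add_right]
    abel
  · rw [fundamentalField_eq ha]
    refine Prod.ext ?_ ?_
    · simp [hx']
    · simp

/-- The stabilizer of x acts transitively on the spheres of the tangent space; here is the
infinitesimal form, with the multiple of v accounting for the radial part of Y. -/
theorem exists_fundamental_vertical {p : Mat n × Mat n} (hp : p ∈ discBundle n 1) (h0 : p.2 ≠ 0)
    {Y : Mat n} (hY : IsTangent p.1 Y) :
    ∃ a ∈ su n, ∃ c : ℝ, (0, Y) = fundamentalField a p + c • ((0, p.2) : Mat n × Mat n) := by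
  obtain ⟨hx, hv, h1⟩ := mem_discBundle.1 hp
  have hr : ip n p.2 p.2 ≠ 0 := fun h => h0 (ip_self_eq_zero hv.skew h)
  set r := ip n p.2 p.2 with hrd
  set c := ip n p.2 Y / r with hc
  have hZ : IsTangent p.1 (Y - c • p.2) := by
    refine ⟨?_, ?_⟩
    · simp [hv.skew, hY.skew]; abel
    · simp only [J_sub_right, J_smul_right, hv.J_J, hY.J_J]; module
  have hvZ : ip n p.2 (Y - c • p.2) = 0 := by
    rw [map_sub, map_smul, ← hrd, smul_eq_mul, hc, div_mul_cancel₀ _ hr, sub_self]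
  obtain ⟨b, hb⟩ := curvature hx hv hZ
  rw [hvZ, ← hrd] at hb
  set Z := Y - c • p.2 with hZd
  have hJs : (J p.2 Z)ᴴ = -J p.2 Z := conjTranspose_J hv.skew hZ.skew
  have hxs := conjTranspose_of_mem_CP hx
  have ha : ((4 / r) • (J p.2 Z - b • p.1))ᴴ = -((4 / r) • (J p.2 Z - b • p.1)) := by
    rw [Matrix.conjTranspose_smul, Matrix.conjTranspose_sub, Matrix.conjTranspose_smul, hJs, hxs]
    simp only [star_trivial]
    module
  -- For Z orthogonal to v, `curvature` gives [[v, Z], v] = b [x, v] + (r/4) Z with r = |v|².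
  -- Subtracting b x cancels the first term, and both [v, Z] and x commute with x.
  refine ⟨(4 / r) • (J p.2 Z - b • p.1), ⟨ha, ?_⟩, c, ?_⟩
  · simp [trace_J, trace_of_mem_CP hx]
  · rw [fundamentalField_eq ha]
    refine Prod.ext ?_ ?_
    · have := J_base_J hx hv hZ
      change 0 = J _ p.1 + c • (0 : Mat n)
      rw [J_skew, J_smul_right, J_sub_right, this, J_smul_right, J_self]
      simp
    · simp only [J_smul_left, J_sub_left, hb, Prod.snd_add, Prod.smul_snd]
      rw [hZd]
      match_scalars <;> field_simp <;> ring

/-! ### The pullback of the product form -/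

theorem fubiniStudy_swap (x X Y : Mat n) : fubiniStudy n x X Y = -fubiniStudy n x Y X := by
  rw [fubiniStudy, fubiniStudy, ip_J_left, ip_comm]

theorem fubiniStudy_add (x X Y Z : Mat n) :
    fubiniStudy n x (X + Y) Z = fubiniStudy n x X Z + fubiniStudy n x Y Z := by
  simp [fubiniStudy, J_add_right]

theorem fubiniStudy_smul (c : ℝ) (x X Z : Mat n) :
    fubiniStudy n x (c • X) Z = c * fubiniStudy n x X Z := by
  simp [fubiniStudy, J_smul_right]

/-- Antisymmetric bilinear forms. -/
structure IsTwoForm {E : Type*} [AddCommGroup E] [Module ℝ E] (B : E → E → ℝ) : Prop where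
  add : ∀ X Y Z, B (X + Y) Z = B X Z + B Y Z
  smul : ∀ (c : ℝ) X Z, B (c • X) Z = c * B X Z
  swap : ∀ X Y, B X Y = -B Y X

section TwoForms

variable {E : Type*} [AddCommGroup E] [Module ℝ E] {B : E → E → ℝ}

theorem IsTwoForm.self (h : IsTwoForm B) (X : E) : B X X = 0 := by linarith [h.swap X X]

theorem IsTwoForm.add_right (h : IsTwoForm B) (X Y Z : E) : B X (Y + Z) = B X Y + B X Z := by
  rw [h.swap, h.add, h.swap Y, h.swap Z]; ring

theorem IsTwoForm.smul_right (h : IsTwoForm B) (c : ℝ) (X Y : E) : B X (c • Y) = c * B X Y := by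
  rw [h.swap, h.smul, h.swap Y]; ring

end TwoForms

theorem isTwoForm_productForm (R R' : ℝ) (p : Mat n × Mat n) :
    IsTwoForm (productForm n R R' p) where
  add X Y Z := by simp only [productForm, Prod.fst_add, Prod.snd_add, fubiniStudy_add]; ring
  smul c X Z := by simp only [productForm, Prod.smul_fst, Prod.smul_snd, fubiniStudy_smul]; ring
  swap X Y := by
    rw [productForm, productForm, fubiniStudy_swap p.1, fubiniStudy_swap p.2]; ring

theorem isTwoForm_magneticForm (s : ℝ) (p : Mat n × Mat n) :
    IsTwoForm (magneticForm n s p) where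
  add X Y Z := by
    simp only [magneticForm_eq, Prod.fst_add, Prod.snd_add, fubiniStudy_add, map_add,
      LinearMap.add_apply]
    ring
  smul c X Z := by
    simp only [magneticForm_eq, Prod.smul_fst, Prod.smul_snd, fubiniStudy_smul, map_smul,
      LinearMap.smul_apply, smul_eq_mul]
    ring
  swap X Y := by rw [magneticForm_eq, magneticForm_eq, fubiniStudy_swap p.1]; ring

section Pullback

variable {R R' : ℝ} {p : Mat n × Mat n}

theorem hasDerivAt_toPair_comp (hR : 0 < R) (hR' : 0 < R') (hp : p ∈ discBundle n 1)
    {γ : ℝ → Mat n × Mat n} {ξ : Mat n × Mat n} (h0 : γ 0 = p) (hγ : HasDerivAt γ ξ 0) :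
    HasDerivAt (toPair R R' ∘ γ) (fderiv ℝ (toPair R R') p ξ) 0 := by
  subst h0
  have hd : DifferentiableAt ℝ (toPair R R') (γ 0) :=
    ((contDiffOn_toPair hR hR').contDiffAt
      (isOpen_unitFiber.mem_nhds (mem_discBundle.1 hp).2.2)).differentiableAt (by simp)
  exact hd.hasFDerivAt.comp_hasDerivAt 0 hγ

theorem isCurveThrough_toPair_comp (hn : 1 ≤ n) (hR : 0 < R) (hR' : 0 < R')
    (hRR : 4 * R * R' = 1) {γ : ℝ → Mat n × Mat n} (hγ : IsCurveThrough (discBundle n 1) p γ) :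
    IsCurveThrough (offAntidiagonal n) (toPair R R' p) (toPair R R' ∘ γ) := by
  obtain ⟨h0, ε, hε, hs, hM⟩ := hγ
  refine ⟨by rw [Function.comp_apply, h0], ε, hε, ?_,
    fun t ht => toPair_mem hn hR hR' hRR (hM t ht)⟩
  exact (contDiffOn_toPair hR hR').comp hs fun t ht => (mem_discBundle.1 (hM t ht)).2.2

theorem fderiv_toPair_fundamentalField (hR : 0 < R) (hR' : 0 < R') (hp : p ∈ discBundle n 1)
    {a : Mat n} (ha : aᴴ = -a) :
    fderiv ℝ (toPair R R') p (fundamentalField a p) = fundamentalField a (toPair R R' p) := by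
  rw [fundamentalField_eq ha, fundamentalField_eq ha]
  refine (hasDerivAt_toPair_comp hR hR' hp (isCurveThrough_orbit hp ha).1
    (hasDerivAt_diagAct_exp ha p)).unique ?_
  have : toPair R R' ∘ (fun t : ℝ => diagAct (NormedSpace.exp (t • a)) p) =
      fun t : ℝ => diagAct (NormedSpace.exp (t • a)) (toPair R R' p) :=
    funext fun t => toPair_diagAct (conjTranspose_exp_mul_exp (by simp [ha])) p
  rw [this]
  exact hasDerivAt_diagAct_exp ha _

/-- By equivariance dF maps a^# to a^#, so both sides are the derivative of the same function (μ₁,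
a) = (μ₂ ∘ F, a) along the curve. -/
theorem pullback_fundamentalField (hn : 1 ≤ n) (hR : 0 < R) (hR' : 0 < R')
    (hRR : 4 * R * R' = 1) (hp : p ∈ discBundle n 1) {a : Mat n} (ha : a ∈ su n)
    {γ : ℝ → Mat n × Mat n} {ξ : Mat n × Mat n} (hγ : IsCurveThrough (discBundle n 1) p γ)
    (hd : HasDerivAt γ ξ 0) :
    productForm n R R' (toPair R R' p) (fderiv ℝ (toPair R R') p (fundamentalField a p))
      (fderiv ℝ (toPair R R') p ξ) = magneticForm n (R' - R) p (fundamentalField a p) ξ := by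
  have h1 := (isMomentMap_pairMoment R R').hamiltonian a ha _ (toPair_mem hn hR hR' hRR hp) _
    (isCurveThrough_toPair_comp hn hR hR' hRR hγ)
  have h2 := (isMomentMap_discMoment (R' - R)).hamiltonian a ha p hp γ hγ
  have e1 : deriv (toPair R R' ∘ γ) 0 = fderiv ℝ (toPair R R') p ξ :=
    (hasDerivAt_toPair_comp hR hR' hp hγ.1 hd).deriv
  have e2 : deriv γ 0 = ξ := hd.deriv
  rw [e1] at h1
  rw [e2] at h2
  rw [fderiv_toPair_fundamentalField hR hR' hp ha.1, h1, h2]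
  simp only [Function.comp_apply, pairMoment_toPair hR hR' hRR]

/-- Lets the vertical derivative of F at the zero section be read off from continuity of the
coefficients alone. -/
theorem hasDerivAt_id_smul {E : Type*} [NormedAddCommGroup E] [NormedSpace ℝ E] {g : ℝ → E}
    (hg : ContinuousAt g 0) : HasDerivAt (fun t => t • g t) (g 0) 0 := by
  rw [hasDerivAt_iff_tendsto_slope_zero]
  refine (hg.tendsto.mono_left nhdsWithin_le_nhds).congr' ?_
  filter_upwards [self_mem_nhdsWithin] with t ht
  simp [smul_smul, inv_mul_cancel₀ (show t ≠ 0 from ht)]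

theorem toPair_vertical (x Y : Mat n) (t : ℝ) : toPair R R' (x, (0 : Mat n) + t • Y) =
    (x, x) + t • (-(t * kCoeff R R' √(1 - t * (t * ip n Y Y))) • J Y (J x Y) -
        mCoeff R R' √(1 - t * (t * ip n Y Y)) • J x Y,
      -(t * kCoeff R' R √(1 - t * (t * ip n Y Y))) • J Y (J x Y) +
        mCoeff R' R √(1 - t * (t * ip n Y Y)) • J x Y) := by
  simp only [toPair, turn, zero_add, J_smul_left, J_smul_right, map_smul, LinearMap.smul_apply,
    smul_eq_mul]
  refine Prod.ext ?_ ?_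
  · simp only [Prod.fst_add, Prod.smul_fst]; module
  · simp only [Prod.snd_add, Prod.smul_snd]; module

theorem fderiv_toPair_vertical (hR : 0 < R) (hR' : 0 < R') (hp : p ∈ discBundle n 1)
    (h0 : p.2 = 0) (Y : Mat n) : fderiv ℝ (toPair R R') p (0, Y) =
      (-(mCoeff R R' 1 • J p.1 Y), mCoeff R' R 1 • J p.1 Y) := by
  obtain ⟨x, v⟩ := p
  obtain rfl : v = 0 := h0
  have h1 := hasDerivAt_toPair_comp hR hR' hp (by simp) (hasDerivAt_vertical x 0 Y)
  refine h1.unique ?_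
  have h2 : toPair R R' ∘ (fun t : ℝ => (x, (0 : Mat n) + t • Y)) = _ :=
    funext fun t => toPair_vertical x Y t
  rw [h2]
  have hρ : Continuous fun t : ℝ => √(1 - t * (t * ip n Y Y)) := by fun_prop
  have hk : ∀ {R R' : ℝ}, 0 < R → 0 < R' →
      Continuous fun t : ℝ => kCoeff R R' √(1 - t * (t * ip n Y Y)) := fun hR hR' =>
    continuous_const.div (continuous_const.add hρ) fun t => by positivity
  have hm : ∀ {R R' : ℝ}, 0 < R → 0 < R' →
      Continuous fun t : ℝ => mCoeff R R' √(1 - t * (t * ip n Y Y)) := fun hR hR' =>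
    (continuous_const.add (continuous_const.mul hρ)).div (continuous_const.add hρ)
      fun t => by positivity
  have h3 := hasDerivAt_id_smul (g := fun t : ℝ =>
      (-(t * kCoeff R R' √(1 - t * (t * ip n Y Y))) • J Y (J x Y) -
        mCoeff R R' √(1 - t * (t * ip n Y Y)) • J x Y,
      -(t * kCoeff R' R √(1 - t * (t * ip n Y Y))) • J Y (J x Y) +
        mCoeff R' R √(1 - t * (t * ip n Y Y)) • J x Y))
    (((((continuous_id.mul (hk hR hR')).neg.smul continuous_const).sub
      ((hm hR hR').smul continuous_const)).prodMk
        (((continuous_id.mul (hk hR' hR)).neg.smul continuous_const).add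
      ((hm hR' hR).smul continuous_const))).continuousAt)
  refine (h3.const_add (x, x)).congr_deriv ?_
  simp

/-- As 2√(RR') = 1, R + R' + 1 = (√R + √R')², so both sides equal (√R + √R')⁻². -/
theorem coeff_vertical (hR : 0 < R) (hR' : 0 < R') (hRR : 4 * R * R' = 1) :
    R * mCoeff R R' 1 ^ 2 = R' * mCoeff R' R 1 ^ 2 := by
  have : R + R' + 1 ≠ 0 := by positivity
  simp only [mCoeff, add_comm R' R]
  field_simp
  linear_combination (R' - R) * hRR

/-- The fibres are Lagrangian for the magnetic form, and on the image vectors the two summands of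
the product form cancel by `coeff_vertical`. -/
theorem pullback_vertical (hR : 0 < R) (hR' : 0 < R')
    (hRR : 4 * R * R' = 1) (hp : p ∈ discBundle n 1) (h0 : p.2 = 0) (Y Z : Mat n) :
    productForm n R R' (toPair R R' p) (fderiv ℝ (toPair R R') p (0, Y))
      (fderiv ℝ (toPair R R') p (0, Z)) = magneticForm n (R' - R) p (0, Y) (0, Z) := by
  have h1 := coeff_vertical hR hR' hRR
  have h2 : toPair R R' p = (p.1, p.1) := by
    simp [toPair, turn, h0, J_zero_right]
  rw [fderiv_toPair_vertical hR hR' hp h0, fderiv_toPair_vertical hR hR' hp h0, magneticForm_eq, h2]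
  simp only [productForm, fubiniStudy, J_neg_right, J_smul_right, J_zero_right, map_neg, map_smul,
    map_zero, LinearMap.neg_apply, LinearMap.smul_apply, smul_eq_mul]
  linear_combination (ip n (J p.1 (J p.1 Y)) (J p.1 Z)) * h1

/-- The difference B of the two forms vanishes if one argument is fundamental; what remains is a
pair of vertical vectors, which off the zero section reduces to B(v, v) = 0. -/
theorem pullback_eq (hn : 1 ≤ n) (hR : 0 < R) (hR' : 0 < R') (hRR : 4 * R * R' = 1)
    (hp : p ∈ discBundle n 1) {γ δ : ℝ → Mat n × Mat n} {ξ η : Mat n × Mat n}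
    (hγ : IsCurveThrough (discBundle n 1) p γ) (hδ : IsCurveThrough (discBundle n 1) p δ)
    (hξ : HasDerivAt γ ξ 0) (hη : HasDerivAt δ η 0) :
    productForm n R R' (toPair R R' p) (fderiv ℝ (toPair R R') p ξ)
      (fderiv ℝ (toPair R R') p η) = magneticForm n (R' - R) p ξ η := by
  set L := fderiv ℝ (toPair R R') p
  set B : Mat n × Mat n → Mat n × Mat n → ℝ := fun X Y =>
    productForm n R R' (toPair R R' p) (L X) (L Y) - magneticForm n (R' - R) p X Y with hB
  have hP := isTwoForm_productForm R R' (toPair R R' p)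
  have hM := isTwoForm_magneticForm (R' - R) p
  have hB2 : IsTwoForm B :=
    ⟨fun X Y Z => by simp only [hB, map_add, hP.add, hM.add]; ring,
      fun c X Z => by simp only [hB, map_smul, hP.smul, hM.smul]; ring,
      fun X Y => by simp only [hB]; rw [hP.swap, hM.swap]; ring⟩
  have hf : ∀ a ∈ su n, ∀ γ ξ, IsCurveThrough (discBundle n 1) p γ → HasDerivAt γ ξ 0 →
      B (fundamentalField a p) ξ = 0 := fun a ha γ ξ hγ hξ =>
    sub_eq_zero.2 (pullback_fundamentalField hn hR hR' hRR hp ha hγ hξ)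
  have hff : ∀ a ∈ su n, ∀ b ∈ su n, B (fundamentalField a p) (fundamentalField b p) = 0 :=
    fun a ha b hb => hf a ha _ _ (isCurveThrough_orbit hp hb.1) (by
      rw [fundamentalField_eq hb.1]; exact hasDerivAt_diagAct_exp hb.1 p)
  have hfv : ∀ a ∈ su n, ∀ Y, IsTangent p.1 Y → B (fundamentalField a p) (0, Y) = 0 :=
    fun a ha Y hY => hf a ha _ _ (isCurveThrough_vertical hp hY) (hasDerivAt_vertical _ _ _)
  have hvv : ∀ Y Z, IsTangent p.1 Y → IsTangent p.1 Z → B (0, Y) (0, Z) = 0 := fun Y Z hY hZ => by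
    by_cases h0 : p.2 = 0
    · exact sub_eq_zero.2 (pullback_vertical hR hR' hRR hp h0 Y Z)
    obtain ⟨a, ha, c, hY'⟩ := exists_fundamental_vertical hp h0 hY
    obtain ⟨b, hb, d, hZ'⟩ := exists_fundamental_vertical hp h0 hZ
    have hv := (mem_discBundle.1 hp).2.1
    rw [hY', hB2.add, hfv a ha Z hZ, hZ', hB2.smul, hB2.add_right, hB2.smul_right, hB2.self,
      hB2.swap, hfv b hb _ hv]
    ring
  obtain ⟨a, ha, Y, hY, rfl⟩ := exists_fundamental_add_vertical hp hγ hξ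
  obtain ⟨b, hb, Z, hZ, rfl⟩ := exists_fundamental_add_vertical hp hδ hη
  refine sub_eq_zero.1 (?_ : B _ _ = 0)
  rw [hB2.add, hB2.add_right, hB2.add_right, hff a ha b hb, hfv a ha Z hZ, hvv Y Z hY hZ,
    hB2.swap, hfv b hb Y hY]
  ring

end Pullback

theorem isSymplectomorphism_toPair (hn : 1 ≤ n) {R R' : ℝ} (hR : 0 < R) (hR' : 0 < R')
    (hRR : 4 * R * R' = 1) :
    IsSymplectomorphism (discBundle n 1) (magneticForm n (R' - R)) (offAntidiagonal n)
      (productForm n R R') (toPair R R') where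
  bijOn := toPair_bijOn hn hR hR' hRR
  smooth := isSmoothOn_of_contDiffOn isOpen_unitFiber (fun _ hp => (mem_discBundle.1 hp).2.2)
    (contDiffOn_toPair hR hR')
  smooth_inv := ⟨fromPair R R', ⟨fun _ hp => fromPair_toPair hR hR' hRR hp,
      fun _ hp => (fromPair_mem hn hR hR' hRR hp).2⟩,
    isSmoothOn_of_contDiffOn isOpen_overlap_pos
      (fun _ hp => ((mem_offAntidiagonal hn).1 hp).2.2) (contDiffOn_fromPair hR hR')⟩
  pullback p hp γ δ hγ hδ := by
    have e1 := (hasDerivAt_toPair_comp hR hR' hp hγ.1 hγ.hasDerivAt).deriv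
    have e2 := (hasDerivAt_toPair_comp hR hR' hp hδ.1 hδ.hasDerivAt).deriv
    have := pullback_eq hn hR hR' hRR hp hγ hδ hγ.hasDerivAt hδ.hasDerivAt
    rw [← e1, ← e2] at this
    exact this

/-- The two components of `toPair` lie on the geodesic with initial velocity `J x v`. -/
theorem exists_toPair_eq_geod {R R' : ℝ} (hR : 0 < R) (hR' : 0 < R') (hRR : 4 * R * R' = 1) :
    ∃ c : ℝ → ℝ, ∀ x v : Mat n, x ∈ CP n → IsTangent x v → ip n v v < 1 →
      turn (kCoeff R R' √(1 - ip n v v)) (mCoeff R R' √(1 - ip n v v)) x v =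
          geod x v (-c √(ip n v v)) ∧
        turn (kCoeff R R' √(1 - ip n v v)) (-mCoeff R R' √(1 - ip n v v)) x v =
          geod x v (c √(ip n v v)) := by
  have h : ∀ r : ℝ, ∃ c, r ^ 2 < 1 →
      Real.cos (c * r) = 1 - kCoeff R R' √(1 - r ^ 2) * r ^ 2 ∧
        Real.sin (c * r) = mCoeff R R' √(1 - r ^ 2) * r := fun r => by
    by_cases hr : r ^ 2 < 1
    · have := coeff_circle hR hR' hRR (Real.sqrt_nonneg (1 - r ^ 2))
      rw [Real.sq_sqrt (by linarith), sub_sub_cancel] at this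
      obtain ⟨c, hc⟩ := exists_angle this
      exact ⟨c, fun _ => hc⟩
    -- Radii r with r² ≥ 1 do not occur in the disc bundle; the value 0 there is a default.
    · exact ⟨0, fun h => absurd h hr⟩
  choose c hc using h
  refine ⟨c, fun x v hx hv h1 => ?_⟩
  have hr := Real.sq_sqrt (ip_self_nonneg hv.skew)
  obtain ⟨h2, h3⟩ := hc √(ip n v v) (by rwa [hr])
  rw [hr] at h2 h3
  refine ⟨turn_eq_geod hx hv h2 h3, ?_⟩
  rw [turn_eq_geod hx hv (c := -c √(ip n v v)), neg_neg]
  · rw [neg_mul, Real.cos_neg, h2]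
  · rw [neg_mul, Real.sin_neg, h3, neg_mul]

end CPn

end

theorem mainTheorem3 (n : ℕ) (hn : 1 ≤ n) (s R₁ R₂ : ℝ)
    (hR₁ : R₁ = (Real.sqrt (s ^ 2 + 1) - s) / 2) (hR₂ : R₂ = (Real.sqrt (s ^ 2 + 1) + s) / 2) :
    ∃ F : CPn.Mat n × CPn.Mat n → CPn.Mat n × CPn.Mat n,
      CPn.IsSymplectomorphism (CPn.discBundle n 1) (CPn.magneticForm n s)
        (CPn.offAntidiagonal n) (CPn.productForm n R₁ R₂) F ∧
      (∀ g ∈ CPn.SU n, ∀ p ∈ CPn.discBundle n 1,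
        F (CPn.diagAct g p) = CPn.diagAct g (F p)) ∧
      (∃ μ₁ μ₂ : CPn.Mat n × CPn.Mat n → CPn.Mat n,
        CPn.IsMomentMap (CPn.discBundle n 1) (CPn.magneticForm n s) μ₁ ∧
        CPn.IsMomentMap (CPn.offAntidiagonal n) (CPn.productForm n R₁ R₂) μ₂ ∧
        ∀ p ∈ CPn.discBundle n 1, μ₂ (F p) = μ₁ p) ∧
      (∃ c₁ c₂ : ℝ → ℝ, ∀ x v : CPn.Mat n, (x, v) ∈ CPn.discBundle n 1 →
        ∃ γ : ℝ → CPn.Mat n, CPn.IsGeodesic γ ∧ γ 0 = x ∧ deriv γ 0 = CPn.J x v ∧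
          F (x, v) = (γ (-c₁ (Real.sqrt (CPn.ip n v v))),
            γ (c₂ (Real.sqrt (CPn.ip n v v))))) := by
  have hsq := Real.sq_sqrt (show 0 ≤ s ^ 2 + 1 by positivity)
  have habs : |s| < √(s ^ 2 + 1) := by
    rw [← Real.sqrt_sq_eq_abs]
    exact Real.sqrt_lt_sqrt (sq_nonneg s) (by linarith)
  obtain ⟨hs1, hs2⟩ := abs_lt.1 habs
  have hR : 0 < R₁ := by rw [hR₁]; linarith
  have hR' : 0 < R₂ := by rw [hR₂]; linarith
  have hRR : 4 * R₁ * R₂ = 1 := by rw [hR₁, hR₂]; linear_combination hsq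
  obtain rfl : s = R₂ - R₁ := by rw [hR₁, hR₂]; ring
  obtain ⟨c₁, hc₁⟩ := CPn.exists_toPair_eq_geod (n := n) hR hR' hRR
  obtain ⟨c₂, hc₂⟩ := CPn.exists_toPair_eq_geod (n := n) hR' hR (by linarith)
  refine ⟨CPn.toPair R₁ R₂, CPn.isSymplectomorphism_toPair hn hR hR' hRR,
    fun g hg p _ => CPn.toPair_diagAct (CPn.conjTranspose_mul_self_of_mem_SU hg) p,
    ⟨CPn.discMoment (R₂ - R₁), CPn.pairMoment R₁ R₂, CPn.isMomentMap_discMoment _,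
      CPn.isMomentMap_pairMoment _ _, fun p _ => CPn.pairMoment_toPair hR hR' hRR p⟩,
    c₁, c₂, fun x v hp => ?_⟩
  obtain ⟨hx, hv, h1⟩ := CPn.mem_discBundle.1 hp
  refine ⟨CPn.geod x v, CPn.isGeodesic_geod hx hv, CPn.geod_zero x v, ?_, ?_⟩
  · rw [CPn.deriv_geod hv.skew, CPn.Ad_zero_exp]
  · exact Prod.ext (hc₁ x v hx hv h1).1 (hc₂ x v hx hv h1).2
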